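/- Let $1 < k \le n$ be integers. Let $\mathrm{NC}_{n+1}$ be the lattice of noncrossing partitions of the vertices of a convex $(n+1)$-gon, labeled $1,\dots,n+1$ in clockwise order, ordered by refinement, and let $\mathrm{Link}(\mathrm{NC}_{n+1})$ be the order complex of $\mathrm{NC}_{n+1}$ with its minimum and maximum elements removed. To each $\pi\in\mathrm{NC}_{n+1}$ associate the permutation, also denoted $\pi$, that sends each vertex to the clockwise next vertex of its block. A maximal chain $\pi_0<\pi_1<\dots<\pi_n$ of $\mathrm{NC}_{n+1}$ gives transpositions $t_i=\pi_{i-1}^{-1}\pi_i$ (permutations are composed from right to left), which satisfy $t_1t_2\cdots t_n=(1,2,\dots,n+1)$; the maximal simplex $\{\pi_1,\dots,\pi_{n-1}\}$ of $\mathrm{Link}(\mathrm{NC}_{n+1})$ is labeled by the $n$-tuple whose $i$-th entry is the smaller of the two numbers exchanged by $t_i$. (By a theorem of Stanley this is a bijection from maximal chains to parking functions of length $n$, that is, $n$-tuples of positive integers whose weakly increasing rearrangement has $i$-th entry at most $i$ for every $i$.) Let $\mathrm{PF}_{n,k}$ be the set of parking functions of length $n$ for which $k$ is the largest element of $\{1,\dots,n\}$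 that does not occur as an entry. Then the maximal simplices labeled by the elements of $\mathrm{PF}_{n,k}$, together with all their faces, form a subcomplex of $\mathrm{Link}(\mathrm{NC}_{n+1})$ whose geometric realization is contractible. -/

import Mathlib

namespace NoncrossingParking

/-! ### Noncrossing partitions -/

/-- A partition of the vertices `0, …, N - 1` (in clockwise order) of a convex `N`-gon, given as an
equivalence relation, is noncrossing if no two distinct blocks cross, that is, if the convex hulls
of distinct blocks are disjoint. -/
def IsNoncrossing {N : ℕ} (r : Setoid (Fin N)) : Prop :=
  ∀ a b c d : Fin N, a < b → b < c → c < d → r a c → r b d → r a b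

/-- The poset of noncrossing partitions of a convex `N`-gon; the order, inherited from `Setoid`, is
refinement: `π ≤ π'` iff every block of `π` is contained in a block of `π'`. -/
abbrev NC (N : ℕ) : Type := {r : Setoid (Fin N) // IsNoncrossing r}

theorem isNoncrossing_bot (N : ℕ) : IsNoncrossing (⊥ : Setoid (Fin N)) := by
  intro a b c d hab hbc _ hac _
  have h : a = c := hac
  exact absurd h (ne_of_lt (hab.trans hbc))

theorem isNoncrossing_top (N : ℕ) : IsNoncrossing (⊤ : Setoid (Fin N)) :=
  fun _ _ _ _ _ _ _ _ _ => trivial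

/-- The bounding elements: the partition into singletons and the partition with one block. -/
instance instBoundedOrderNC (N : ℕ) : BoundedOrder (NC N) where
  bot := ⟨⊥, isNoncrossing_bot N⟩
  bot_le x := show (⊥ : Setoid (Fin N)) ≤ x.1 from bot_le
  top := ⟨⊤, isNoncrossing_top N⟩
  le_top x := show x.1 ≤ (⊤ : Setoid (Fin N)) from le_top

instance instFiniteNC (N : ℕ) : Finite (NC N) :=
  Finite.of_injective (fun (x : NC N) (a b : Fin N) => x.1 a b)
    (fun _ _ h => Subtype.ext (Setoid.ext fun a b => iff_of_eq (congrFun (congrFun h a) b)))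

/-! ### Noncrossing permutations -/

open Classical in
/-- The clockwise next vertex after `v` in the block of `v`: the smallest larger element of the
block if there is one, and otherwise the smallest element of the block. -/
noncomputable def nextInBlock {N : ℕ} (r : Setoid (Fin N)) (v : Fin N) : Fin N :=
  if h : (Finset.univ.filter fun w => r v w ∧ v < w).Nonempty then
    (Finset.univ.filter fun w => r v w ∧ v < w).min' h
  else
    (Finset.univ.filter fun w => r v w).min'
      ⟨v, Finset.mem_filter.2 ⟨Finset.mem_univ v, r.refl v⟩⟩

theorem nextInBlock_spec {N : ℕ} (r : Setoid (Fin N)) (v : Fin N) :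
    r v (nextInBlock r v) ∧
      ((v < nextInBlock r v ∧ ∀ w, r v w → v < w → nextInBlock r v ≤ w) ∨
        ((∀ w, r v w → w ≤ v) ∧ ∀ w, r v w → nextInBlock r v ≤ w)) := by
  classical
  unfold nextInBlock
  split_ifs with h
  · have hm := Finset.min'_mem _ h
    rw [Finset.mem_filter] at hm
    refine ⟨hm.2.1, Or.inl ⟨hm.2.2, fun w hw hvw => ?_⟩⟩
    exact Finset.min'_le _ _ (Finset.mem_filter.2 ⟨Finset.mem_univ w, hw, hvw⟩)
  · have hm := Finset.min'_mem (Finset.univ.filter fun w => r v w)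
      ⟨v, Finset.mem_filter.2 ⟨Finset.mem_univ v, r.refl v⟩⟩
    rw [Finset.mem_filter] at hm
    refine ⟨hm.2, Or.inr ⟨fun w hw => ?_, fun w hw => ?_⟩⟩
    · by_contra hlt
      exact h ⟨w, Finset.mem_filter.2 ⟨Finset.mem_univ w, hw, not_le.1 hlt⟩⟩
    · exact Finset.min'_le _ _ (Finset.mem_filter.2 ⟨Finset.mem_univ w, hw⟩)

theorem nextInBlock_injective {N : ℕ} (r : Setoid (Fin N)) :
    Function.Injective (nextInBlock r) := by
  intro v w h
  obtain ⟨hv, hv'⟩ := nextInBlock_spec r v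
  obtain ⟨hw, hw'⟩ := nextInBlock_spec r w
  rw [← h] at hw hw'
  have hvw : r v w := r.trans hv (r.symm hw)
  have hwv : r w v := r.symm hvw
  rcases hv' with ⟨h1, h2⟩ | ⟨h1, h2⟩ <;> rcases hw' with ⟨h3, h4⟩ | ⟨h3, h4⟩
  · rcases lt_trichotomy v w with hlt | heq | hgt
    · exact absurd (h2 w hvw hlt) (not_le.2 h3)
    · exact heq
    · exact absurd (h4 v hwv hgt) (not_le.2 h1)
  · exact absurd (h4 v hwv) (not_le.2 h1)
  · exact absurd (h2 w hvw) (not_le.2 h3)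
  · exact le_antisymm (h3 v hwv) (h1 w hvw)

/-- The permutation of the vertices associated to a partition: each vertex is sent to the clockwise
next vertex of its block. -/
noncomputable def perm {N : ℕ} (r : Setoid (Fin N)) : Equiv.Perm (Fin N) :=
  Equiv.ofBijective (nextInBlock r) (Finite.injective_iff_bijective.1 (nextInBlock_injective r))

/-! ### Maximal chains and their labels -/

/-- A maximal chain `⊥ = p 0 ⋖ p 1 ⋖ ⋯ ⋖ p n = ⊤` of the noncrossing partitions of a convex
`(n + 1)`-gon (this poset is graded of rank `n`). -/
def IsMaximalChain {n : ℕ} (p : Fin (n + 1) → NC (n + 1)) : Prop :=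
  p 0 = ⊥ ∧ p (Fin.last n) = ⊤ ∧ ∀ i : Fin n, p i.castSucc ⋖ p i.succ

/-- The smallest label of a vertex moved by `τ`, where the vertices `0, 1, 2, …` carry the labels
`1, 2, 3, …`. For a transposition this is the smaller of the two labels exchanged. -/
noncomputable def smallestMoved {N : ℕ} (τ : Equiv.Perm (Fin N)) : ℕ :=
  sInf {m : ℕ | ∃ v : Fin N, τ v ≠ v ∧ m = (v : ℕ) + 1}

/-- The `n`-tuple of a maximal chain `p`. The transpositions `tᵢ = (perm pᵢ₋₁)⁻¹ * perm pᵢ` give a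
factorization `t₁ * ⋯ * tₙ` of the cycle `(1, 2, …, n + 1)`, and the `i`-th entry of the tuple is
the smallest number moved by `tᵢ`. -/
noncomputable def stanleyWord {n : ℕ} (p : Fin (n + 1) → NC (n + 1)) : Fin n → ℕ :=
  fun i => smallestMoved ((perm (p i.castSucc).1)⁻¹ * perm (p i.succ).1)

/-! ### Parking functions -/

/-- Parking functions of length `n`: tuples of positive integers whose weakly increasing
rearrangement has `i`-th entry at most `i`. -/
def PF (n : ℕ) : Set (Fin n → ℕ) :=
  {a | (∀ i, 1 ≤ a i) ∧ ∀ i : Fin n, a (Tuple.sort a i) ≤ (i : ℕ) + 1}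

/-- Parking functions of length `n` for which `k` is the largest of the parking spaces `1, …, n`
that is undesired, i.e. that does not occur as an entry. -/
def PFUndesired (n k : ℕ) : Set (Fin n → ℕ) :=
  {a | a ∈ PF n ∧ IsGreatest {j : ℕ | 1 ≤ j ∧ j ≤ n ∧ ∀ i, a i ≠ j} k}

/-! ### Simplicial complexes -/

/-- The link of a bounded poset: the order complex of the poset with its bounding elements removed,
whose simplices are the nonempty finite chains that avoid `⊥` and `⊤`. -/
def link (P : Type*) [PartialOrder P] [BoundedOrder P] : PreAbstractSimplicialComplex P where
  faces := {s | s.Nonempty ∧ IsChain (· ≤ ·) (s : Set P) ∧ ⊥ ∉ s ∧ ⊤ ∉ s}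
  isRelLowerSet_faces := by
    rintro s ⟨hs, hc, hb, ht⟩
    exact ⟨hs, fun t hts hne =>
      ⟨hne, hc.mono (Finset.coe_subset.2 hts), fun h => hb (hts h), fun h => ht (hts h)⟩⟩

/-- The complex formed by the simplices labeled by `A`: it consists of the maximal simplices
`{p 1, …, p (n - 1)}` for the maximal chains `p` with label in `A`, and all their faces. -/
def labeledComplex {n : ℕ} (A : Set (Fin n → ℕ)) : PreAbstractSimplicialComplex (NC (n + 1)) where
  faces := {s | s.Nonempty ∧ ∃ p : Fin (n + 1) → NC (n + 1), IsMaximalChain p ∧ stanleyWord p ∈ A ∧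
    ∀ x ∈ s, x ≠ ⊥ ∧ x ≠ ⊤ ∧ x ∈ Set.range p}
  isRelLowerSet_faces := by
    rintro s ⟨hs, p, hp, hA, hsub⟩
    exact ⟨hs, fun t hts hne => ⟨hne, p, hp, hA, fun x hx => hsub x (hts hx)⟩⟩

/-- The geometric realization of a simplicial complex on a finite set of vertices: the points of
`V → ℝ` with nonnegative coordinates that sum to `1` and are supported on a face. -/
def realization {V : Type*} [Finite V] (K : PreAbstractSimplicialComplex V) : Set (V → ℝ) :=
  {x | (∀ v, 0 ≤ x v) ∧ ∃ s ∈ K, (∀ v, v ∉ s → x v = 0) ∧ ∑ v ∈ s, x v = 1}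

end NoncrossingParking

/-! Number the vertices from 0. Each step of a maximal chain merges two blocks; let `m` be the
larger of their minima and `a` the vertex just before `m` in the merged block. The label of the step
is `a + 1` (`IsMergeable.smallestMoved_eq`), and `m` runs once through all nonzero vertices
(`IsMaximalChain.exists_steps`).

Let `κ` be the vertex with number `k`, hence with label `k + 1`, and let `u` be its predecessor. All
labels in `k + 1, …, n` occur iff every `m > κ` is merged with `a = m - 1`; this is
`IsTailConsecutive`. Given this, `k` is missing iff the step that joins `u` to `κ` inserts the block
of `u` into the block of `κ` directly after some `j < u`; this is `IsAttachedAt`. Both conditions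
concern single partitions, so the chains in question are those that stay in one of the subposets
`cornerSet κ j` (`IsMaximalChain.stanleyWord_mem_iff`). Any chain in `cornerSet κ j` extends to a
chain there that is maximal in the whole lattice (`exists_isMaximalChain`). Hence the complex is the
union of the order complexes of the proper parts of the `cornerSet κ j`.

For a nonempty set `R` of corners, let `h R x` merge all blocks of `x` that meet `R ∪ {κ}`. On the
proper part of the intersection over `R` this gives `x ≤ h R x ≥ h R ⊥`, a conical contraction. It
is monotone in `R`, so the contractions glue (`contractibleSpace_of_conical`), by homotopies between
maps that are affine on a subdivision by flags of faces. -/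

namespace NoncrossingParking

/-! ### Maps of realizations from assignments of vertices to faces -/

section Realization

variable {V : Type*} [Fintype V]

theorem mem_of_ne_zero {K : PreAbstractSimplicialComplex V} {x : V → ℝ}
    (hx : x ∈ realization K) : ∃ s ∈ K, ∀ v, x v ≠ 0 → v ∈ s := by
  obtain ⟨-, s, hs, h, -⟩ := hx
  exact ⟨s, hs, fun v hv => by_contra fun hvs => hv (h v hvs)⟩

theorem sum_eq_one {K : PreAbstractSimplicialComplex V} {x : V → ℝ}
    (hx : x ∈ realization K) : ∑ v, x v = 1 := by
  obtain ⟨-, s, hs, h, h1⟩ := hx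
  rw [← h1]
  exact (Finset.sum_subset (Finset.subset_univ s) fun v _ hv => h v hv).symm

theorem mem_realization_of {K : PreAbstractSimplicialComplex V} {x : V → ℝ}
    (h0 : ∀ v, 0 ≤ x v) (h1 : ∑ v, x v = 1) {s : Finset V} (hs : s ∈ K)
    (h : ∀ v, x v ≠ 0 → v ∈ s) : x ∈ realization K := by
  refine ⟨h0, s, hs, fun v hv => by_contra fun hne => hv (h v hne), ?_⟩
  rw [← h1]
  exact Finset.sum_subset (Finset.subset_univ s) fun v _ hv => by_contra fun hne => hv (h v hne)

/-- Two maps to the realization of a simplicial complex are homotopic if the images of each point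
lie in a common simplex. -/
theorem homotopic_of_common_face {X : Type*} [TopologicalSpace X]
    {K : PreAbstractSimplicialComplex V} (f g : C(X, realization K))
    (h : ∀ x, ∃ s ∈ K, ∀ v, (f x : V → ℝ) v ≠ 0 ∨ (g x : V → ℝ) v ≠ 0 → v ∈ s) :
    f.Homotopic g := by
  refine ⟨⟨⟨fun p => ⟨fun v => (1 - (p.1 : ℝ)) * (f p.2 : V → ℝ) v + p.1 * (g p.2 : V → ℝ) v, ?_⟩,
    ?_⟩, ?_, ?_⟩⟩
  · obtain ⟨s, hs, hsv⟩ := h p.2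
    have hp0 : (0 : ℝ) ≤ p.1 := p.1.2.1
    have hp1 : (0 : ℝ) ≤ 1 - p.1 := sub_nonneg.2 p.1.2.2
    refine mem_realization_of (fun v => ?_) ?_ hs fun v hv => hsv v ?_
    · exact add_nonneg (mul_nonneg hp1 ((f p.2).2.1 v)) (mul_nonneg hp0 ((g p.2).2.1 v))
    · rw [Finset.sum_add_distrib, ← Finset.mul_sum, ← Finset.mul_sum, sum_eq_one (f p.2).2,
        sum_eq_one (g p.2).2]
      ring
    · by_contra! hne
      simp [hne.1, hne.2] at hv
  · have hf : ∀ v, Continuous fun x => (f x : V → ℝ) v := fun v =>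
      (continuous_apply v).comp (continuous_subtype_val.comp f.continuous)
    have hg : ∀ v, Continuous fun x => (g x : V → ℝ) v := fun v =>
      (continuous_apply v).comp (continuous_subtype_val.comp g.continuous)
    refine Continuous.subtype_mk (continuous_pi fun v => ?_) _
    exact ((continuous_const.sub (continuous_subtype_val.comp continuous_fst)).mul
      ((hf v).comp continuous_snd)).add
      ((continuous_subtype_val.comp continuous_fst).mul ((hg v).comp continuous_snd))
  · intro x
    ext v
    simp
  · intro x
    ext v
    simp

open Classical in
/-- A function on the realization which is positive exactly at the points at which the set `s` is a
superlevel set, i.e. in the open star of the barycentre of `s` in the barycentric subdivision. -/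
noncomputable def flagWeight (s : Finset V) (x : V → ℝ) : ℝ :=
  if s.Nonempty then ∏ v ∈ s, (x v * ∏ u ∈ sᶜ, max 0 (x v - x u)) else 0

theorem continuous_flagWeight (s : Finset V) :
    Continuous (flagWeight (V := V) s) := by
  unfold flagWeight
  split_ifs <;> fun_prop

theorem flagWeight_nonneg (s : Finset V) {x : V → ℝ} (hx : ∀ v, 0 ≤ x v) :
    0 ≤ flagWeight s x := by
  unfold flagWeight
  split_ifs
  · exact Finset.prod_nonneg fun v _ => mul_nonneg (hx v)
      (Finset.prod_nonneg fun u _ => le_max_left _ _)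
  · exact le_rfl

theorem flagWeight_ne_zero {s : Finset V} {x : V → ℝ} (h : flagWeight s x ≠ 0) :
    s.Nonempty ∧ ∀ v ∈ s, x v ≠ 0 ∧ ∀ u, u ∉ s → x u < x v := by
  unfold flagWeight at h
  split_ifs at h with hs
  · refine ⟨hs, fun v hv => ?_⟩
    have hv' := Finset.prod_ne_zero_iff.1 h v hv
    refine ⟨left_ne_zero_of_mul hv', fun u hu => ?_⟩
    have hu' := Finset.prod_ne_zero_iff.1 (right_ne_zero_of_mul hv') u (by simpa using hu)
    by_contra! hle
    exact hu' (max_eq_left (sub_nonpos.2 hle))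
  · exact absurd rfl h

/-- The support of `x` is itself a superlevel set. -/
theorem exists_flagWeight_ne_zero {K : PreAbstractSimplicialComplex V} {x : V → ℝ}
    (hx : x ∈ realization K) : ∃ s, flagWeight s x ≠ 0 := by
  classical
  have hne : (Finset.univ.filter fun v => x v ≠ 0).Nonempty := by
    by_contra hemp
    rw [Finset.not_nonempty_iff_eq_empty, Finset.filter_eq_empty_iff] at hemp
    have h1 := sum_eq_one hx
    rw [Finset.sum_eq_zero fun v hv => not_not.1 (hemp hv)] at h1
    exact zero_ne_one h1
  refine ⟨Finset.univ.filter fun v => x v ≠ 0, ?_⟩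
  rw [flagWeight, if_pos hne]
  refine Finset.prod_ne_zero_iff.2 fun v hv => ?_
  have hv0 : x v ≠ 0 := (Finset.mem_filter.1 hv).2
  refine mul_ne_zero hv0 (Finset.prod_ne_zero_iff.2 fun u hu => ?_)
  have hu0 : x u = 0 := by simpa using hu
  rw [hu0, sub_zero]
  exact ne_of_gt (lt_max_of_lt_right (lt_of_le_of_ne (hx.1 v) hv0.symm))

/-- The flag of faces whose barycentres span the simplex of the barycentric subdivision around `x`. -/
noncomputable def flag (x : V → ℝ) : Finset (Finset V) :=
  open Classical in Finset.univ.filter fun s => flagWeight s x ≠ 0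

theorem mem_flag {x : V → ℝ} {s : Finset V} : s ∈ flag x ↔ flagWeight s x ≠ 0 := by
  simp [flag]

/-- A nonempty set of faces that is totally ordered by inclusion. -/
def IsFlag (K : PreAbstractSimplicialComplex V) (F : Finset (Finset V)) : Prop :=
  F.Nonempty ∧ IsChain (· ⊆ ·) (F : Set (Finset V)) ∧ ∀ s ∈ F, s ∈ K

/-- Superlevel sets are nested: vertices witnessing that two of them are incomparable would each
have the larger coordinate. Their coordinates are nonzero, so they lie in the support. -/
theorem isFlag_flag {K : PreAbstractSimplicialComplex V} {x : V → ℝ}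
    (hx : x ∈ realization K) : IsFlag K (flag x) := by
  refine ⟨?_, ?_, fun s hs => ?_⟩
  · obtain ⟨s, hs⟩ := exists_flagWeight_ne_zero hx
    exact ⟨s, mem_flag.2 hs⟩
  · intro s hs t ht _
    have hs' := flagWeight_ne_zero (mem_flag.1 hs)
    have ht' := flagWeight_ne_zero (mem_flag.1 ht)
    by_contra! hne
    obtain ⟨v, hv, hvt⟩ := Finset.not_subset.1 hne.1
    obtain ⟨u, hu, hus⟩ := Finset.not_subset.1 hne.2
    exact lt_asymm ((hs'.2 v hv).2 u hus) ((ht'.2 u hu).2 v hvt)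
  · have hs' := flagWeight_ne_zero (mem_flag.1 hs)
    obtain ⟨t, ht, hxt⟩ := mem_of_ne_zero hx
    exact (K.isRelLowerSet_faces ht).2 (fun v hv => hxt v (hs'.2 v hv).1) hs'.1

open Classical in
/-- Two assignments of vertices to faces are contiguous if they take the faces of each flag to
vertices that together form a face. -/
def Contiguous (K : PreAbstractSimplicialComplex V) (φ ψ : Finset V → V) : Prop :=
  ∀ F, IsFlag K F → F.image φ ∪ F.image ψ ∈ K

theorem Contiguous.refl_left {K : PreAbstractSimplicialComplex V} {φ ψ : Finset V → V}
    (h : Contiguous K φ ψ) : Contiguous K φ φ := fun F hF => by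
  classical
  exact (K.isRelLowerSet_faces (h F hF)).2 (by
    rw [Finset.union_self]
    exact Finset.subset_union_left) ((hF.1.image φ).mono Finset.subset_union_left)

theorem Contiguous.symm {K : PreAbstractSimplicialComplex V} {φ ψ : Finset V → V}
    (h : Contiguous K φ ψ) : Contiguous K ψ φ := fun F hF => by
  classical
  rw [Finset.union_comm]
  exact h F hF

open Classical in
/-- The coordinates of the map that is affine on the simplices around which the flags are constant
and takes each face to the assigned vertex. -/
noncomputable def subdivisionCoord (φ : Finset V → V) (x : V → ℝ) (v : V) : ℝ :=
  (∑ s, if φ s = v then flagWeight s x else 0) / ∑ s, flagWeight s x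

theorem sum_flagWeight_pos {K : PreAbstractSimplicialComplex V} {x : V → ℝ}
    (hx : x ∈ realization K) : 0 < ∑ s, flagWeight s x := by
  obtain ⟨s, hs⟩ := exists_flagWeight_ne_zero hx
  exact Finset.sum_pos' (fun s _ => flagWeight_nonneg s hx.1)
    ⟨s, Finset.mem_univ s, lt_of_le_of_ne (flagWeight_nonneg s hx.1) hs.symm⟩

theorem subdivisionCoord_ne_zero {φ : Finset V → V} {x : V → ℝ} {v : V}
    (h : subdivisionCoord φ x v ≠ 0) : ∃ s ∈ flag x, φ s = v := by
  classical
  by_contra! hne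
  refine h ?_
  rw [subdivisionCoord, Finset.sum_eq_zero, zero_div]
  intro s _
  split_ifs with hs
  · by_contra h0
    exact hne s (mem_flag.2 h0) hs
  · rfl

/-- The map of realizations induced by an assignment of vertices to faces. -/
noncomputable def subdivisionMap {K : PreAbstractSimplicialComplex V}
    {φ : Finset V → V} (h : Contiguous K φ φ) : C(realization K, realization K) where
  toFun x := ⟨subdivisionCoord φ x, by
    classical
    have hpos := sum_flagWeight_pos x.2
    refine mem_realization_of (fun v => ?_) ?_ (h _ (isFlag_flag x.2)) fun v hv => ?_
    · refine div_nonneg (Finset.sum_nonneg fun s _ => ?_) hpos.le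
      split_ifs
      · exact flagWeight_nonneg s x.2.1
      · exact le_rfl
    · simp only [subdivisionCoord]
      rw [← Finset.sum_div, Finset.sum_comm]
      simp only [Finset.sum_ite_eq, Finset.mem_univ, if_true]
      exact div_self hpos.ne'
    · obtain ⟨s, hs, rfl⟩ := subdivisionCoord_ne_zero hv
      exact Finset.mem_union_left _ (Finset.mem_image_of_mem φ hs)⟩
  continuous_toFun := by
    classical
    refine Continuous.subtype_mk (continuous_pi fun v => ?_) _
    refine Continuous.div ?_ ?_ fun x => (sum_flagWeight_pos x.2).ne'
    · refine continuous_finsetSum _ fun s _ => ?_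
      split_ifs
      · exact (continuous_flagWeight s).comp continuous_subtype_val
      · exact continuous_const
    · exact continuous_finsetSum _ fun s _ =>
        (continuous_flagWeight s).comp continuous_subtype_val

theorem Contiguous.homotopic {K : PreAbstractSimplicialComplex V}
    {φ ψ : Finset V → V} (h : Contiguous K φ ψ) :
    (subdivisionMap h.refl_left).Homotopic (subdivisionMap h.symm.refl_left) := by
  classical
  refine homotopic_of_common_face _ _ fun x => ⟨_, h _ (isFlag_flag x.2), fun v hv => ?_⟩
  rcases hv with hv | hv <;> obtain ⟨s, hs, rfl⟩ := subdivisionCoord_ne_zero hv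
  · exact Finset.mem_union_left _ (Finset.mem_image_of_mem φ hs)
  · exact Finset.mem_union_right _ (Finset.mem_image_of_mem ψ hs)

/-- The faces in the flag of `x` lie in the support of `x`, so a choice of a vertex from each face
keeps `x` in its own simplex. -/
theorem homotopic_id {K : PreAbstractSimplicialComplex V} {φ : Finset V → V}
    (h : Contiguous K φ φ) (hφ : ∀ s ∈ K, φ s ∈ s) :
    (ContinuousMap.id (realization K)).Homotopic (subdivisionMap h) := by
  refine homotopic_of_common_face _ _ fun x => ?_
  obtain ⟨t, ht, hxt⟩ := mem_of_ne_zero x.2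
  refine ⟨t, ht, fun v hv => ?_⟩
  rcases hv with hv | hv
  · exact hxt v hv
  · obtain ⟨s, hs, rfl⟩ := subdivisionCoord_ne_zero hv
    have hsK := (isFlag_flag x.2).2.2 s hs
    exact hxt _ ((flagWeight_ne_zero (mem_flag.1 hs)).2 _ (hφ s hsK)).1

end Realization

/-! ### Gluing conical contractions of subposets -/

section Order

variable {P ι : Type*} [PartialOrder P]

/-- An assignment of elements of a poset to faces that reverses the order and does not leave any
member of the cover `Q` that contains the face. -/
def IsCarried (K : PreAbstractSimplicialComplex P) (Q : ι → Set P) (φ : Finset P → P) : Prop :=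
  (∀ s ∈ K, ∀ t ∈ K, s ⊆ t → φ t ≤ φ s) ∧ ∀ s ∈ K, ∀ j, (s : Set P) ⊆ Q j → φ s ∈ Q j

/-- For faces `s ⊂ t`, the elements `φ s` and `ψ t` need not be comparable, so `φ` cannot be
replaced by `ψ` at once. Replacing it on faces of one cardinality at a time, smallest first, only
puts `φ t` beside `ψ s`, and `φ t ≤ ψ t ≤ ψ s`. -/
theorem homotopic_of_isCarried_of_le [Fintype P] {K : PreAbstractSimplicialComplex P}
    {Q : ι → Set P}
    (hK : ∀ s, s ∈ K ↔ s.Nonempty ∧ IsChain (· ≤ ·) (s : Set P) ∧ ∃ j, (s : Set P) ⊆ Q j)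
    {φ ψ : Finset P → P} (hφ : IsCarried K Q φ) (hψ : IsCarried K Q ψ)
    (hle : ∀ s ∈ K, φ s ≤ ψ s) :
    ∃ (h₁ : Contiguous K φ φ) (h₂ : Contiguous K ψ ψ),
      (subdivisionMap h₁).Homotopic (subdivisionMap h₂) := by
  classical
  let χ : ℕ → Finset P → P := fun m s => if s.card ≤ m then ψ s else φ s
  have hχ : ∀ m, Contiguous K (χ m) (χ (m + 1)) := by
    intro m F hF
    have hval : ∀ s, χ m s = φ s ∧ m < s.card ∨ χ m s = ψ s ∧ s.card ≤ m := by
      intro s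
      simp only [χ]
      split_ifs with h
      · exact Or.inr ⟨rfl, h⟩
      · exact Or.inl ⟨rfl, not_le.1 h⟩
    have hval' : ∀ s, χ (m + 1) s = φ s ∧ m + 1 < s.card ∨ χ (m + 1) s = ψ s ∧ s.card ≤ m + 1 := by
      intro s
      simp only [χ]
      split_ifs with h
      · exact Or.inr ⟨rfl, h⟩
      · exact Or.inl ⟨rfl, not_le.1 h⟩
    have hmem : ∀ x ∈ F.image (χ m) ∪ F.image (χ (m + 1)), ∃ s ∈ F,
        (x = φ s ∧ m < s.card) ∨ (x = ψ s ∧ s.card ≤ m + 1) := by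
      intro x hx
      rcases Finset.mem_union.1 hx with hx | hx <;> obtain ⟨s, hs, rfl⟩ := Finset.mem_image.1 hx
      · rcases hval s with h | h
        · exact ⟨s, hs, Or.inl h⟩
        · exact ⟨s, hs, Or.inr ⟨h.1, h.2.trans (Nat.le_succ m)⟩⟩
      · rcases hval' s with h | h
        · exact ⟨s, hs, Or.inl ⟨h.1, (Nat.lt_succ_self m).trans h.2⟩⟩
        · exact ⟨s, hs, Or.inr h⟩
    have key : ∀ s ∈ F, ∀ t ∈ F, s ⊂ t → ∀ x y,
        ((x = φ s ∧ m < s.card) ∨ (x = ψ s ∧ s.card ≤ m + 1)) →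
        ((y = φ t ∧ m < t.card) ∨ (y = ψ t ∧ t.card ≤ m + 1)) → y ≤ x := by
      intro s hs t ht hst x y hx hy
      have hcard := Finset.card_lt_card hst
      have hsK := hF.2.2 s hs
      have htK := hF.2.2 t ht
      rcases hx with ⟨rfl, hx⟩ | ⟨rfl, hx⟩ <;> rcases hy with ⟨rfl, hy⟩ | ⟨rfl, hy⟩
      · exact hφ.1 s hsK t htK hst.1
      -- The bad pair `φ s`, `ψ t` would need `m < s.card < t.card ≤ m + 1`.
      · omega
      · exact (hle t htK).trans (hψ.1 s hsK t htK hst.1)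
      · exact hψ.1 s hsK t htK hst.1
    rw [hK]
    refine ⟨(hF.1.image _).mono Finset.subset_union_left, ?_, ?_⟩
    · intro x hx y hy _
      obtain ⟨s, hs, hxs⟩ := hmem x hx
      obtain ⟨t, ht, hyt⟩ := hmem y hy
      rcases eq_or_ne s t with rfl | hne
      · have := hle s (hF.2.2 s hs)
        rcases hxs with ⟨rfl, -⟩ | ⟨rfl, -⟩ <;> rcases hyt with ⟨rfl, -⟩ | ⟨rfl, -⟩ <;>
          simp [this]
      · rcases hF.2.1 hs ht hne with hst | hst
        · exact Or.inr (key s hs t ht (lt_of_le_of_ne hst hne) x y hxs hyt)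
        · exact Or.inl (key t ht s hs (lt_of_le_of_ne hst hne.symm) y x hyt hxs)
    · obtain ⟨t, ht, hmax⟩ := F.exists_max_image Finset.card hF.1
      have hsub : ∀ s ∈ F, s ⊆ t := by
        intro s hs
        rcases hF.2.1.total hs ht with h | h
        · exact h
        · exact (Finset.eq_of_subset_of_card_le h (hmax s hs)).symm.subset
      obtain ⟨-, -, j, hj⟩ := (hK t).1 (hF.2.2 t ht)
      refine ⟨j, fun x hx => ?_⟩
      obtain ⟨s, hs, hxs⟩ := hmem x hx
      have hsj : (s : Set P) ⊆ Q j := (Finset.coe_subset.2 (hsub s hs)).trans hj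
      rcases hxs with ⟨rfl, -⟩ | ⟨rfl, -⟩
      · exact hφ.2 s (hF.2.2 s hs) j hsj
      · exact hψ.2 s (hF.2.2 s hs) j hsj
  have hstep : ∀ m, (subdivisionMap (hχ 0).refl_left).Homotopic
      (subdivisionMap (hχ m).refl_left) := by
    intro m
    induction m with
    | zero => exact ContinuousMap.Homotopic.refl _
    | succ m ih => exact ih.trans (hχ m).homotopic
  have hend : χ (Fintype.card P) = ψ := by
    funext s
    exact if_pos s.card_le_univ
  have hflag : ∀ {θ θ' : Finset P → P}, (∀ s ∈ K, θ s = θ' s) → Contiguous K θ θ →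
      Contiguous K θ' θ' := by
    intro θ θ' hθ h F hF
    rw [← Finset.image_congr (g := θ') fun s hs => hθ s (hF.2.2 s hs)]
    exact h F hF
  -- This can fail at the empty set, which is not a face and has weight zero.
  have hstart : ∀ s ∈ K, χ 0 s = φ s := by
    intro s hs
    refine if_neg ?_
    have := (((hK s).1 hs).1).card_pos
    omega
  have h₁ := hflag hstart (hχ 0).refl_left
  have hlast := hstep (Fintype.card P)
  refine ⟨h₁, hend ▸ (hχ (Fintype.card P)).refl_left, ?_⟩
  have heq : subdivisionMap h₁ = subdivisionMap (hχ 0).refl_left := by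
    ext x v
    change subdivisionCoord φ x v = subdivisionCoord (χ 0) x v
    simp only [subdivisionCoord]
    congr 1
    refine Finset.sum_congr rfl fun s _ => ?_
    by_cases hs : s ∈ flag (x : P → ℝ)
    · rw [hstart s ((isFlag_flag x.2).2.2 s hs)]
    · have h0 : flagWeight s (x : P → ℝ) = 0 := by_contra fun h => hs (mem_flag.2 h)
      simp [h0]
  have heq' : subdivisionMap (hend ▸ (hχ (Fintype.card P)).refl_left) =
      subdivisionMap (hχ (Fintype.card P)).refl_left := by
    ext x v
    change subdivisionCoord ψ x v = subdivisionCoord (χ (Fintype.card P)) x v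
    rw [hend]
  rw [heq, heq']
  exact hlast

/-- A union of order complexes of subposets `Q j` is contractible if the intersections of the `Q j`
are compatibly conically contractible. -/
theorem contractibleSpace_of_conical [Finite P] [Nonempty ι]
    {K : PreAbstractSimplicialComplex P} {Q : ι → Set P}
    (hK : ∀ s, s ∈ K ↔ s.Nonempty ∧ IsChain (· ≤ ·) (s : Set P) ∧ ∃ j, (s : Set P) ⊆ Q j)
    (h : Set ι → P → P) (e : Set ι → P)
    (hmem : ∀ R : Set ι, R.Nonempty → ∀ x ∈ ⋂ j ∈ R, Q j, h R x ∈ ⋂ j ∈ R, Q j)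
    (hle : ∀ R : Set ι, R.Nonempty → ∀ x ∈ ⋂ j ∈ R, Q j, x ≤ h R x)
    (hmono : ∀ R R' : Set ι, R.Nonempty → R ⊆ R' → ∀ x ∈ ⋂ j ∈ R, Q j, ∀ x' ∈ ⋂ j ∈ R', Q j,
      x ≤ x' → h R x ≤ h R' x')
    (emem : ∀ R : Set ι, R.Nonempty → e R ∈ ⋂ j ∈ R, Q j)
    (emono : ∀ R R' : Set ι, R.Nonempty → R ⊆ R' → e R ≤ e R')
    (ele : ∀ R : Set ι, R.Nonempty → ∀ x ∈ ⋂ j ∈ R, Q j, e R ≤ h R x) :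
    ContractibleSpace (realization K) := by
  classical
  have := Fintype.ofFinite P
  have hmin : ∀ s : Finset P, ∃ x, s ∈ K → x ∈ s ∧ ∀ y ∈ s, x ≤ y := by
    intro s
    by_cases hs : s ∈ K
    · obtain ⟨hne, hc, -⟩ := (hK s).1 hs
      obtain ⟨x, hx⟩ := s.exists_minimal hne
      refine ⟨x, fun _ => ⟨hx.prop, fun y hy => ?_⟩⟩
      rcases hc.total hx.prop hy with hxy | hyx
      · exact hxy
      · exact hx.le_of_le hy hyx
    · exact ⟨e Set.univ, fun h => absurd h hs⟩
  -- The minimum of the face rather than its maximum: enlarging a face then lowers both `b` and the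
  -- set `S` below, in accordance with the monotonicity of `h` in both arguments.
  choose b hb using hmin
  let S : Finset P → Set ι := fun s => {j | (s : Set P) ⊆ Q j}
  have hS : ∀ s ∈ K, (S s).Nonempty := fun s hs => ((hK s).1 hs).2.2
  have hSanti : ∀ s t : Finset P, s ⊆ t → S t ⊆ S s := fun s t hst j hj =>
    (Finset.coe_subset.2 hst).trans hj
  have hbS : ∀ s ∈ K, b s ∈ ⋂ j ∈ S s, Q j := fun s hs =>
    Set.mem_iInter₂.2 fun j hj => hj (Finset.mem_coe.2 (hb s hs).1)
  have hbanti : ∀ s ∈ K, ∀ t ∈ K, s ⊆ t → b t ≤ b s := fun s hs t ht hst =>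
    (hb t ht).2 _ (hst (hb s hs).1)
  have c₀ : IsCarried K Q b :=
    ⟨hbanti, fun s hs j hj => hj (Finset.mem_coe.2 (hb s hs).1)⟩
  have c₁ : IsCarried K Q fun s => h (S s) (b s) :=
    ⟨fun s hs t ht hst => hmono _ _ (hS t ht) (hSanti s t hst) _ (hbS t ht) _ (hbS s hs)
      (hbanti s hs t ht hst),
      fun s hs j hj => Set.mem_iInter₂.1 (hmem _ (hS s hs) _ (hbS s hs)) j hj⟩
  have c₂ : IsCarried K Q fun s => e (S s) :=
    ⟨fun s hs t ht hst => emono _ _ (hS t ht) (hSanti s t hst),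
      fun s hs j hj => Set.mem_iInter₂.1 (emem _ (hS s hs)) j hj⟩
  have c₃ : IsCarried K Q fun _ => e Set.univ :=
    ⟨fun s hs t ht hst => le_rfl, fun s hs j hj =>
      Set.mem_iInter₂.1 (emem _ Set.univ_nonempty) j (Set.mem_univ j)⟩
  -- The zigzag from the identity to a constant: `b ≤ h (S ·) (b ·) ≥ e (S ·) ≤ e univ`.
  obtain ⟨a₀, a₁, h01⟩ := homotopic_of_isCarried_of_le hK c₀ c₁
    fun s hs => hle _ (hS s hs) _ (hbS s hs)
  obtain ⟨a₂, a₁', h21⟩ := homotopic_of_isCarried_of_le hK c₂ c₁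
    fun s hs => ele _ (hS s hs) _ (hbS s hs)
  obtain ⟨a₂', a₃, h23⟩ := homotopic_of_isCarried_of_le hK c₂ c₃
    fun s hs => emono _ _ (hS s hs) (Set.subset_univ _)
  have hw : ({e Set.univ} : Finset P) ∈ K := by
    rw [hK]
    obtain ⟨j⟩ := ‹Nonempty ι›
    refine ⟨Finset.singleton_nonempty _, by simp, j, ?_⟩
    simpa using Set.mem_iInter₂.1 (emem _ Set.univ_nonempty) j (Set.mem_univ j)
  let pt : realization K := ⟨Pi.single (e Set.univ) 1,
    mem_realization_of (fun v => by by_cases hv : v = e Set.univ <;> simp [hv])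
      (by simp) hw fun v hv => by
        by_contra hne
        rw [Finset.mem_singleton] at hne
        simp [hne] at hv⟩
  have hconst : subdivisionMap a₃ = ContinuousMap.const _ pt := by
    ext x v
    change subdivisionCoord (fun _ => e Set.univ) x v = (Pi.single (e Set.univ) 1 : P → ℝ) v
    by_cases hv : v = e Set.univ
    · subst hv
      simp [subdivisionCoord, div_self (sum_flagWeight_pos x.2).ne']
    · simp [subdivisionCoord, hv, Ne.symm hv]
  refine (contractible_iff_id_nullhomotopic _).2 ⟨pt, ?_⟩
  rw [← hconst]
  exact (((homotopic_id a₀ fun s hs => (hb s hs).1).trans h01).trans h21.symm).trans h23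

end Order

end NoncrossingParking

namespace NoncrossingParking

/-! ### Merging the blocks that meet a given set -/

section Adjoin

variable {N : ℕ}

/-- The partition obtained by merging all blocks that meet the set `E`. -/
def adjoin (r : Setoid (Fin N)) (E : Set (Fin N)) : Setoid (Fin N) where
  r a b := r a b ∨ (∃ e ∈ E, r a e) ∧ ∃ e ∈ E, r b e
  iseqv := by
    refine ⟨fun a => Or.inl (r.refl a), fun {a b} h => ?_, fun {a b c} h h' => ?_⟩
    · rcases h with h | h
      · exact Or.inl (r.symm h)
      · exact Or.inr ⟨h.2, h.1⟩
    · rcases h with h | ⟨h1, h2⟩ <;> rcases h' with h' | ⟨h3, h4⟩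
      · exact Or.inl (r.trans h h')
      · obtain ⟨e, he, hbe⟩ := h3
        exact Or.inr ⟨⟨e, he, r.trans h hbe⟩, h4⟩
      · obtain ⟨e, he, hbe⟩ := h2
        exact Or.inr ⟨h1, e, he, r.trans (r.symm h') hbe⟩
      · exact Or.inr ⟨h1, h4⟩

theorem adjoin_iff {r : Setoid (Fin N)} {E : Set (Fin N)} {a b : Fin N} :
    adjoin r E a b ↔ r a b ∨ (∃ e ∈ E, r a e) ∧ ∃ e ∈ E, r b e := Iff.rfl

theorem adjoin_mono {r r' : Setoid (Fin N)} {E E' : Set (Fin N)} (hr : r ≤ r') (hE : E ⊆ E') :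
    adjoin r E ≤ adjoin r' E' := by
  intro a b h
  rcases adjoin_iff.1 h with h | ⟨⟨e, he, hae⟩, e', he', hbe⟩
  · exact Or.inl (hr h)
  · exact Or.inr ⟨⟨e, hE he, hr hae⟩, e', hE he', hr hbe⟩

theorem le_adjoin (r : Setoid (Fin N)) (E : Set (Fin N)) : r ≤ adjoin r E :=
  fun _ _ h => Or.inl h

theorem adjoin_of_mem (r : Setoid (Fin N)) {E : Set (Fin N)} {a b : Fin N} (ha : a ∈ E)
    (hb : b ∈ E) : adjoin r E a b :=
  Or.inr ⟨⟨a, ha, r.refl a⟩, b, hb, r.refl b⟩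

theorem adjoin_le {r r' : Setoid (Fin N)} {E : Set (Fin N)} (hr : r ≤ r')
    (hE : ∀ a ∈ E, ∀ b ∈ E, r' a b) : adjoin r E ≤ r' := by
  intro a b h
  rcases adjoin_iff.1 h with h | ⟨⟨e, he, hae⟩, e', he', hbe⟩
  · exact hr h
  · exact r'.trans (hr hae) (r'.trans (hE e he e' he') (r'.symm (hr hbe)))

/-- A block not containing the chord `c d` stays on one side of it. -/
theorem IsNoncrossing.between {r : Setoid (Fin N)} (hr : IsNoncrossing r) {c d x y : Fin N}
    (hcd : r c d) (hxy : r x y) (hcx : c < x) (hxd : x < d) (hne : ¬ r c x) : c < y ∧ y < d := by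
  constructor
  · by_contra! hyc
    rcases hyc.lt_or_eq with hyc | rfl
    · exact hne (r.trans (r.symm (hr y c x d hyc hcx hxd (r.symm hxy) hcd)) (r.symm hxy))
    · exact hne (r.symm hxy)
  · by_contra! hyd
    rcases hyd.lt_or_eq with hyd | rfl
    · exact hne (hr c x d y hcx hxd hyd hcd hxy)
    · exact hne (r.trans hcd (r.symm hxy))

theorem IsNoncrossing.not_between {r : Setoid (Fin N)} (hr : IsNoncrossing r) {c d x y : Fin N}
    (hcd : r c d) (hxy : r x y) (hx : x < c ∨ d < x) (hne : ¬ r c x) : y < c ∨ d < y := by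
  by_contra! hy
  have hyc : c ≠ y := by
    rintro rfl
    exact hne (r.symm hxy)
  have hyd : y ≠ d := by
    rintro rfl
    exact hne (r.trans hcd (r.symm hxy))
  have := hr.between hcd (r.symm hxy) (lt_of_le_of_ne hy.1 hyc) (lt_of_le_of_ne hy.2 hyd)
    fun h => hne (r.trans h (r.symm hxy))
  rcases hx with hx | hx
  · exact lt_asymm hx this.1
  · exact lt_asymm hx this.2

/-- Merging the blocks that meet `E` preserves noncrossingness if no other block separates `E`. -/
theorem IsNoncrossing.adjoin {r : Setoid (Fin N)} (hr : IsNoncrossing r) {E : Set (Fin N)}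
    (hE : ∀ c d, r c d → ∀ e ∈ E, c < e → e < d → ∀ e' ∈ E, e' < c ∨ d < e' → ∃ f ∈ E, r c f) :
    IsNoncrossing (adjoin r E) := by
  intro a b c d hab hbc hcd hac hbd
  rcases adjoin_iff.1 hac with hac | ⟨⟨e, he, hae⟩, e', he', hce⟩ <;>
    rcases adjoin_iff.1 hbd with hbd | ⟨⟨f, hf, hbf⟩, f', hf', hdf⟩
  · exact Or.inl (hr a b c d hab hbc hcd hac hbd)
  · refine Or.inr ⟨?_, f, hf, hbf⟩
    by_contra hne
    have hnb : ∀ {x y}, y ∈ E → r x y → ¬ r a x := fun hy hxy hax =>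
      hne ⟨_, hy, r.trans hax hxy⟩
    have h1 := hr.between hac hbf hab hbc (hnb hf hbf)
    exact hne (hE a c hac f hf h1.1 h1.2 f' hf'
      (hr.not_between hac hdf (Or.inr hcd) (hnb hf' hdf)))
  · refine Or.inr ⟨⟨e, he, hae⟩, ?_⟩
    by_contra hne
    have hnb : ∀ {x y}, y ∈ E → r x y → ¬ r b x := fun hy hxy hax =>
      hne ⟨_, hy, r.trans hax hxy⟩
    have h1 := hr.between hbd hce hbc hcd (hnb he' hce)
    exact hne (hE b d hbd e' he' h1.1 h1.2 e he
      (hr.not_between hbd hae (Or.inl hab) (hnb he hae)))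
  · exact Or.inr ⟨⟨e, he, hae⟩, f, hf, hbf⟩

end Adjoin

/-! ### The subposets with a corner and their conical contractions -/

section Corner

variable {N : ℕ}

/-- In a chain of partitions with this property, the last vertices `κ, …, N - 1` are connected by
merging consecutive pairs. -/
def IsTailConsecutive (κ : Fin N) (r : Setoid (Fin N)) : Prop :=
  ∀ l l' i : Fin N, κ < l → (l' : ℕ) + 1 = l → i < l → r l i → r l l'

/-- The vertices strictly between `j` and `κ` are connected to the others only by way of `j`, and
only after `j` and `κ` are connected. -/
def IsAttachedAt (κ j : Fin N) (r : Setoid (Fin N)) : Prop :=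
  ∀ y x : Fin N, j < y → y < κ → (x ≤ j ∨ κ ≤ x) → r y x → r y j ∧ r y κ

/-- The noncrossing partitions with a corner at `j`. -/
def cornerSet (κ j : Fin N) : Set (NC N) :=
  {π | IsTailConsecutive κ π.1 ∧ IsAttachedAt κ j π.1}

theorem bot_mem_cornerSet (κ j : Fin N) : ⊥ ∈ cornerSet κ j := by
  refine ⟨fun l l' i _ _ hil h => ?_, fun y x hjy hyκ hx h => ?_⟩
  · have h : l = i := h
    exact absurd h hil.ne'
  · have h : y = x := h
    subst h
    rcases hx with hx | hx
    · exact absurd hjy hx.not_gt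
    · exact absurd hyκ hx.not_gt

theorem top_mem_cornerSet (κ j : Fin N) : ⊤ ∈ cornerSet κ j :=
  ⟨fun _ _ _ _ _ _ _ => trivial, fun _ _ _ _ _ _ => ⟨trivial, trivial⟩⟩

/-- The vertices at which there may be a corner: those less than the predecessor of `κ`. -/
abbrev CornerIndex (κ : Fin N) : Type := {j : Fin N // (j : ℕ) + 1 < κ}

/-- The set `R` of corners together with `κ`. -/
def cornerBlock (κ : Fin N) (R : Set (CornerIndex κ)) : Set (Fin N) :=
  insert κ (Subtype.val '' R)

theorem mem_cornerBlock {κ : Fin N} {R : Set (CornerIndex κ)} {v : Fin N} :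
    v ∈ cornerBlock κ R ↔ v = κ ∨ ∃ j ∈ R, (j : Fin N) = v := by
  simp [cornerBlock]

theorem CornerIndex.lt {κ : Fin N} (j : CornerIndex κ) : (j : Fin N) < κ :=
  Fin.lt_def.2 ((Nat.lt_succ_self _).trans j.2)

/-- If a chord of a block of `π` separates the merged set, one of its ends lies strictly between
some `j ∈ R` and `κ` and the other does not. Attachment at `j` then puts `κ` into that block, so it
is merged as well. -/
theorem isNoncrossing_adjoin_cornerBlock {κ : Fin N} {R : Set (CornerIndex κ)} {π : NC N}
    (hπ : π ∈ ⋂ j ∈ R, cornerSet κ j) : IsNoncrossing (adjoin π.1 (cornerBlock κ R)) := by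
  rw [Set.mem_iInter₂] at hπ
  have hκ : κ ∈ cornerBlock κ R := mem_cornerBlock.2 (Or.inl rfl)
  refine π.2.adjoin fun c d hcd e he hce hed e' he' hsep => ?_
  rcases hsep with hec | hde
  · rcases mem_cornerBlock.1 he' with rfl | ⟨j', hj', rfl⟩
    · rcases mem_cornerBlock.1 he with rfl | ⟨j, hj, rfl⟩
      · exact absurd (hec.trans hce) (lt_irrefl _)
      · exact absurd (hec.trans hce) j.lt.not_gt
    · rcases lt_or_ge d κ with hdκ | hdκ
      · rcases mem_cornerBlock.1 he with rfl | ⟨j, hj, rfl⟩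
        · exact absurd hed hdκ.not_gt
        · exact ⟨κ, hκ, π.1.trans hcd
            ((hπ j hj).2 d c hed hdκ (Or.inl hce.le) (π.1.symm hcd)).2⟩
      · have hcκ : c < κ := by
          rcases mem_cornerBlock.1 he with rfl | ⟨j, hj, rfl⟩
          · exact hce
          · exact hce.trans j.lt
        exact ⟨κ, hκ, ((hπ j' hj').2 c d hec hcκ (Or.inr hdκ) hcd).2⟩
  · rcases mem_cornerBlock.1 he with rfl | ⟨j, hj, rfl⟩
    · rcases mem_cornerBlock.1 he' with rfl | ⟨j', hj', rfl⟩
      · exact absurd (hed.trans hde) (lt_irrefl _)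
      · exact absurd (hed.trans hde) j'.lt.not_gt
    · have hdκ : d < κ := by
        rcases mem_cornerBlock.1 he' with rfl | ⟨j', hj', rfl⟩
        · exact hde
        · exact hde.trans j'.lt
      exact ⟨κ, hκ, π.1.trans hcd
        ((hπ j hj).2 d c hed hdκ (Or.inl hce.le) (π.1.symm hcd)).2⟩

open Classical in
/-- Merges the blocks that meet `cornerBlock κ R`, if the result is noncrossing. -/
noncomputable def adjoinCorners (κ : Fin N) (R : Set (CornerIndex κ)) (π : NC N) : NC N :=
  if h : IsNoncrossing (adjoin π.1 (cornerBlock κ R)) then ⟨_, h⟩ else π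

theorem adjoinCorners_val {κ : Fin N} {R : Set (CornerIndex κ)} {π : NC N}
    (hπ : π ∈ ⋂ j ∈ R, cornerSet κ j) :
    (adjoinCorners κ R π).1 = adjoin π.1 (cornerBlock κ R) := by
  rw [adjoinCorners, dif_pos (isNoncrossing_adjoin_cornerBlock hπ)]

/-- A vertex beyond `κ` enters the merged block only if `π` already relates it to a smaller vertex,
as nothing in `cornerBlock κ R` exceeds `κ`. New relations between other vertices respect attachment
because the merged block contains `j` and `κ`. -/
theorem adjoinCorners_mem {κ : Fin N} {R : Set (CornerIndex κ)} {π : NC N}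
    (hπ : π ∈ ⋂ j ∈ R, cornerSet κ j) : adjoinCorners κ R π ∈ ⋂ j ∈ R, cornerSet κ j := by
  have hπ' := Set.mem_iInter₂.1 hπ
  refine Set.mem_iInter₂.2 fun j hj => ⟨?_, ?_⟩
  · rw [adjoinCorners_val hπ]
    intro l l' i hκl hl' hil h
    rcases adjoin_iff.1 h with h | ⟨⟨e, he, hle⟩, -⟩
    · exact Or.inl ((hπ' j hj).1 l l' i hκl hl' hil h)
    · have hel : e < l := by
        rcases mem_cornerBlock.1 he with rfl | ⟨j', hj', rfl⟩
        · exact hκl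
        · exact j'.lt.trans hκl
      exact Or.inl ((hπ' j hj).1 l l' e hκl hl' hel hle)
  · rw [adjoinCorners_val hπ]
    intro y x hjy hyκ hx h
    rcases adjoin_iff.1 h with h | ⟨hy, -⟩
    · have := (hπ' j hj).2 y x hjy hyκ hx h
      exact ⟨Or.inl this.1, Or.inl this.2⟩
    · exact ⟨Or.inr ⟨hy, j, mem_cornerBlock.2 (Or.inr ⟨j, hj, rfl⟩), π.1.refl _⟩,
        Or.inr ⟨hy, κ, mem_cornerBlock.2 (Or.inl rfl), π.1.refl _⟩⟩

theorem adjoinCorners_ne_bot {κ : Fin N} {R : Set (CornerIndex κ)} (hR : R.Nonempty) {π : NC N}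
    (hπ : π ∈ ⋂ j ∈ R, cornerSet κ j) : adjoinCorners κ R π ≠ ⊥ := by
  intro h
  obtain ⟨j, hj⟩ := hR
  have h1 : adjoin π.1 (cornerBlock κ R) j κ :=
    adjoin_of_mem _ (mem_cornerBlock.2 (Or.inr ⟨j, hj, rfl⟩)) (mem_cornerBlock.2 (Or.inl rfl))
  rw [← adjoinCorners_val hπ, h] at h1
  have h1 : (j : Fin N) = κ := h1
  exact j.lt.ne h1

/-- The predecessor `u` of `κ` is strictly between every corner and `κ`; this is why corners satisfy
`j + 1 < κ`. If merging yields `⊤`, then `u` meets the merged set already in `π`, and attachment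
relates it to `κ` and to all of `R`. So merging changed nothing and `π = ⊤`. -/
theorem adjoinCorners_ne_top {κ : Fin N} {R : Set (CornerIndex κ)} (hR : R.Nonempty) {π : NC N}
    (hπ : π ∈ ⋂ j ∈ R, cornerSet κ j) (htop : π ≠ ⊤) : adjoinCorners κ R π ≠ ⊤ := by
  intro h
  refine htop (top_le_iff.1 ?_)
  rw [← h]
  change (adjoinCorners κ R π).1 ≤ π.1
  rw [adjoinCorners_val hπ]
  have hπ' := Set.mem_iInter₂.1 hπ
  obtain ⟨j, hj⟩ := hR
  have hjκ := j.2
  let u : Fin N := ⟨(κ : ℕ) - 1, (Nat.sub_le _ _).trans_lt κ.2⟩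
  have hu : (u : ℕ) + 1 = κ := by
    change (κ : ℕ) - 1 + 1 = κ
    omega
  have huκ : u < κ := Fin.lt_def.2 (by omega)
  have hju : ∀ i : CornerIndex κ, (i : Fin N) < u := fun i => by
    have := i.2
    exact Fin.lt_def.2 (by omega)
  have h1 : adjoin π.1 (cornerBlock κ R) u κ := by
    rw [← adjoinCorners_val hπ, h]
    trivial
  have h2 : π.1 u κ := by
    rcases adjoin_iff.1 h1 with h1 | ⟨⟨e, he, hue⟩, -⟩
    · exact h1
    · rcases mem_cornerBlock.1 he with rfl | ⟨i, hi, rfl⟩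
      · exact hue
      · exact ((hπ' i hi).2 u i (hju i) huκ (Or.inl le_rfl) hue).2
  have h3 : ∀ e ∈ cornerBlock κ R, π.1 u e := by
    intro e he
    rcases mem_cornerBlock.1 he with rfl | ⟨i, hi, rfl⟩
    · exact h2
    · exact ((hπ' i hi).2 u κ (hju i) huκ (Or.inr le_rfl) h2).1
  exact adjoin_le le_rfl fun a ha b hb => π.1.trans (π.1.symm (h3 a ha)) (h3 b hb)

theorem adjoinCorners_mono {κ : Fin N} {R R' : Set (CornerIndex κ)} {π π' : NC N}
    (hπ : π ∈ ⋂ j ∈ R, cornerSet κ j) (hπ' : π' ∈ ⋂ j ∈ R', cornerSet κ j) (hR : R ⊆ R')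
    (hle : π ≤ π') : adjoinCorners κ R π ≤ adjoinCorners κ R' π' := by
  change (adjoinCorners κ R π).1 ≤ (adjoinCorners κ R' π').1
  rw [adjoinCorners_val hπ, adjoinCorners_val hπ']
  exact adjoin_mono hle (Set.insert_subset_insert (Set.image_mono hR))

theorem le_adjoinCorners {κ : Fin N} {R : Set (CornerIndex κ)} {π : NC N}
    (hπ : π ∈ ⋂ j ∈ R, cornerSet κ j) : π ≤ adjoinCorners κ R π := by
  change π.1 ≤ (adjoinCorners κ R π).1
  rw [adjoinCorners_val hπ]
  exact le_adjoin _ _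

/-- The complex of chains of proper noncrossing partitions with a common corner is contractible. -/
theorem contractibleSpace_of_cornerSet {κ : Fin N} (hκ : 1 < (κ : ℕ))
    {K : PreAbstractSimplicialComplex (NC N)}
    (hK : ∀ s, s ∈ K ↔ s.Nonempty ∧ IsChain (· ≤ ·) (s : Set (NC N)) ∧
      ∃ j : CornerIndex κ, ∀ x ∈ s, x ∈ cornerSet κ j ∧ x ≠ ⊥ ∧ x ≠ ⊤) :
    ContractibleSpace (realization K) := by
  have : Nonempty (CornerIndex κ) := ⟨⟨⟨0, by omega⟩, by simpa using hκ⟩⟩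
  let Q : CornerIndex κ → Set (NC N) := fun j => {x | x ∈ cornerSet κ j ∧ x ≠ ⊥ ∧ x ≠ ⊤}
  have hQ : ∀ R : Set (CornerIndex κ), R.Nonempty → ∀ x, x ∈ ⋂ j ∈ R, Q j ↔
      x ∈ ⋂ j ∈ R, cornerSet κ j ∧ x ≠ ⊥ ∧ x ≠ ⊤ := by
    intro R hR x
    simp only [Set.mem_iInter₂]
    obtain ⟨i, hi⟩ := hR
    exact ⟨fun h => ⟨fun j hj => (h j hj).1, (h i hi).2⟩, fun h j hj => ⟨h.1 j hj, h.2⟩⟩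
  have hbot : ∀ R : Set (CornerIndex κ), ⊥ ∈ ⋂ j ∈ R, cornerSet κ j := fun R =>
    Set.mem_iInter₂.2 fun j _ => bot_mem_cornerSet κ j
  have hN : (⊥ : NC N) ≠ ⊤ := by
    intro h
    have h1 : (⊤ : NC N).1 ⟨0, by omega⟩ κ := trivial
    rw [← h] at h1
    have h1 : (⟨0, by omega⟩ : Fin N) = κ := h1
    rw [← h1] at hκ
    exact absurd hκ (Nat.not_lt_zero 1)
  refine contractibleSpace_of_conical (Q := Q) hK (adjoinCorners κ)
    (fun R => adjoinCorners κ R ⊥) ?_ ?_ ?_ ?_ ?_ ?_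
  · intro R hR x hx
    rw [hQ R hR] at hx ⊢
    exact ⟨adjoinCorners_mem hx.1, adjoinCorners_ne_bot hR hx.1,
      adjoinCorners_ne_top hR hx.1 hx.2.2⟩
  · intro R hR x hx
    exact le_adjoinCorners ((hQ R hR x).1 hx).1
  · intro R R' hR hRR' x hx x' hx' hle
    exact adjoinCorners_mono ((hQ R hR x).1 hx).1 ((hQ R' (hR.mono hRR') x').1 hx').1 hRR' hle
  · intro R hR
    rw [hQ R hR]
    exact ⟨adjoinCorners_mem (hbot R), adjoinCorners_ne_bot hR (hbot R),
      adjoinCorners_ne_top hR (hbot R) hN⟩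
  · intro R R' hR hRR'
    exact adjoinCorners_mono (hbot R) (hbot R') hRR' le_rfl
  · intro R hR x hx
    exact adjoinCorners_mono (hbot R) ((hQ R hR x).1 hx).1 subset_rfl bot_le

end Corner

end NoncrossingParking

namespace NoncrossingParking

/-! ### Rank as the number of non-minimal vertices -/

section Rank

variable {N : ℕ}

/-- `v` is not the smallest vertex of its block. -/
def NonMin (r : Setoid (Fin N)) (v : Fin N) : Prop := ∃ i < v, r v i

theorem NonMin.mono {r r' : Setoid (Fin N)} (h : r ≤ r') {v : Fin N} (hv : NonMin r v) :
    NonMin r' v := by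
  obtain ⟨i, hi, hvi⟩ := hv
  exact ⟨i, hi, h hvi⟩

theorem exists_not_nonMin (r : Setoid (Fin N)) (v : Fin N) : ∃ w ≤ v, r v w ∧ ¬ NonMin r w := by
  induction v using WellFoundedLT.induction with
  | ind v ih =>
    by_cases h : NonMin r v
    · obtain ⟨i, hi, hvi⟩ := h
      obtain ⟨w, hw, hiw, hmin⟩ := ih i hi
      exact ⟨w, hw.trans hi.le, r.trans hvi hiw, hmin⟩
    · exact ⟨v, le_rfl, r.refl v, h⟩

theorem le_of_not_nonMin {r : Setoid (Fin N)} {v w : Fin N} (hv : ¬ NonMin r v) (h : r v w) :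
    v ≤ w := by
  by_contra! hlt
  exact hv ⟨w, hlt, h⟩

/-- If every minimum of an `r`-block were still a minimum for `r'`, each block of `r'` would contain
only one block of `r`. -/
theorem exists_nonMin_of_lt {r r' : Setoid (Fin N)} (h : r < r') :
    ∃ m, NonMin r' m ∧ ¬ NonMin r m := by
  by_contra! hall
  refine h.not_ge fun a b hab => ?_
  obtain ⟨v, -, hav, hv⟩ := exists_not_nonMin r a
  obtain ⟨w, -, hbw, hw⟩ := exists_not_nonMin r b
  have hvw : r' v w := r'.trans (r'.symm (h.le hav)) (r'.trans hab (h.le hbw))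
  have heq : v = w := le_antisymm
    (le_of_not_nonMin (fun hn => hv (hall v hn)) hvw)
    (le_of_not_nonMin (fun hn => hw (hall w hn)) (r'.symm hvw))
  subst heq
  exact r.trans hav (r.symm hbw)

open Classical in
/-- The rank of a partition: the number of vertices minus the number of blocks. -/
noncomputable def rank (r : Setoid (Fin N)) : ℕ := (Finset.univ.filter (NonMin r)).card

theorem rank_lt_rank {r r' : Setoid (Fin N)} (h : r < r') : rank r < rank r' := by
  classical
  obtain ⟨m, hm', hm⟩ := exists_nonMin_of_lt h
  refine Finset.card_lt_card ((Finset.ssubset_iff_of_subset ?_).2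
    ⟨m, by simpa using hm', by simpa using hm⟩)
  intro v hv
  simp only [Finset.mem_filter, Finset.mem_univ, true_and] at hv ⊢
  exact hv.mono h.le

theorem nonMin_adjoin_pair {r : Setoid (Fin N)} {α β : Fin N} (hα : ¬ NonMin r α)
    (hβ : ¬ NonMin r β) (hlt : α < β) {a b : Fin N} (ha : r a α) (hb : r b β) (v : Fin N) :
    NonMin (adjoin r {a, b}) v ↔ v = β ∨ NonMin r v := by
  constructor
  · rintro ⟨i, hi, hvi⟩
    by_contra! hv
    rcases adjoin_iff.1 hvi with hvi | ⟨⟨e, he, hve⟩, f, hf, hif⟩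
    · exact hv.2 ⟨i, hi, hvi⟩
    · have hvα : r v α := by
        rcases he with rfl | rfl
        · exact r.trans hve ha
        · exact absurd (le_antisymm (le_of_not_nonMin hv.2 (r.trans hve hb))
            (le_of_not_nonMin hβ (r.symm (r.trans hve hb)))) hv.1
      have hv' := le_of_not_nonMin hv.2 hvα
      rcases hf with rfl | rfl
      · exact absurd (le_of_not_nonMin hα (r.symm (r.trans hif ha))) (not_le.2 (hi.trans_le hv'))
      · exact absurd (le_of_not_nonMin hβ (r.symm (r.trans hif hb)))
          (not_le.2 ((hi.trans_le hv').trans hlt))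
  · rintro (rfl | hv)
    · exact ⟨α, hlt, Or.inr ⟨⟨b, by simp, r.symm hb⟩, a, by simp, r.symm ha⟩⟩
    · exact hv.mono (le_adjoin _ _)

theorem rank_adjoin_pair {r : Setoid (Fin N)} {a b : Fin N} (hab : ¬ r a b) :
    rank (adjoin r {a, b}) = rank r + 1 := by
  classical
  have key : ∀ α β : Fin N, ¬ NonMin r α → ¬ NonMin r β → α < β → ∀ a b, r a α → r b β →
      rank (adjoin r {a, b}) = rank r + 1 := by
    intro α β hα hβ hlt a b ha hb
    rw [rank, rank, ← Finset.card_insert_of_notMem (a := β) (by simpa using hβ)]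
    congr 1
    ext v
    simp [nonMin_adjoin_pair hα hβ hlt ha hb]
  obtain ⟨α, -, ha, hα⟩ := exists_not_nonMin r a
  obtain ⟨β, -, hb, hβ⟩ := exists_not_nonMin r b
  rcases lt_trichotomy α β with hlt | rfl | hlt
  · exact key α β hα hβ hlt a b ha hb
  · exact absurd (r.trans ha (r.symm hb)) hab
  · rw [Set.pair_comm]
    exact key β α hβ hα hlt b a hb ha

theorem rank_bot : rank (⊥ : Setoid (Fin N)) = 0 := by
  classical
  rw [rank, Finset.card_eq_zero, Finset.filter_eq_empty_iff]
  rintro v - ⟨i, hi, h⟩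
  have h : v = i := h
  exact hi.ne h.symm

theorem rank_top {n : ℕ} : rank (⊤ : Setoid (Fin (n + 1))) = n := by
  classical
  have : Finset.univ.filter (NonMin (⊤ : Setoid (Fin (n + 1)))) = Finset.univ.erase 0 := by
    ext v
    simp only [Finset.mem_filter, Finset.mem_univ, true_and, Finset.mem_erase, and_true]
    exact ⟨fun ⟨i, hi, _⟩ => ((Fin.zero_le i).trans_lt hi).ne', fun h =>
      ⟨0, Fin.pos_iff_ne_zero.2 h, trivial⟩⟩
  rw [rank, this, Finset.card_erase_of_mem (Finset.mem_univ _)]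
  simp

end Rank

/-! ### Single merges, and extension to maximal chains inside a corner set -/

section Merge

variable {N : ℕ}

/-- `a` and `m` are consecutive in a block of `r'`, and `m` is the smallest vertex of its block in
the finer partition `r`. -/
structure IsMergeable (r r' : Setoid (Fin N)) (a m : Fin N) : Prop where
  lt : a < m
  not_nonMin : ¬ NonMin r m
  rel : r' a m
  consecutive : ∀ v, a < v → v < m → ¬ r' v m

theorem exists_isMergeable {r r' : Setoid (Fin N)} {m : Fin N} (hm : ¬ NonMin r m)
    (hm' : NonMin r' m) : ∃ a, IsMergeable r r' a m := by
  classical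
  obtain ⟨i, hi, hmi⟩ := hm'
  obtain ⟨a, ha, hmax⟩ := (Finset.univ.filter fun v => v < m ∧ r' v m).exists_max_image id
    ⟨i, by simpa using ⟨hi, r'.symm hmi⟩⟩
  simp only [Finset.mem_filter, Finset.mem_univ, true_and, id] at ha hmax
  exact ⟨a, ha.1, hm, ha.2, fun v hav hvm hv => not_le.2 hav (hmax v ⟨hvm, hv⟩)⟩

theorem IsMergeable.not_rel {r r' : Setoid (Fin N)} {a m : Fin N} (h : IsMergeable r r' a m) :
    ¬ r a m := fun ham => h.not_nonMin ⟨a, h.lt, r.symm ham⟩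

/-- An `r`-chord separating `a` from `m` would belong to their `r'`-block, with an end strictly
between these consecutive vertices. -/
theorem IsMergeable.isNoncrossing {r r' : Setoid (Fin N)} {a m : Fin N}
    (h : IsMergeable r r' a m) (hr : IsNoncrossing r) (hr' : IsNoncrossing r') (hle : r ≤ r') :
    IsNoncrossing (adjoin r {a, m}) := by
  refine hr.adjoin fun c d hcd e he hce hed e' he' hsep => ?_
  exfalso
  have ham := h.lt
  have hcd' := hle hcd
  rcases he with rfl | rfl <;> rcases he' with rfl | rfl
  · rcases hsep with hs | hs
    · exact lt_asymm hce hs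
    · exact lt_asymm hed hs
  · rcases hsep with hs | hs
    · exact lt_asymm (hce.trans ham) hs
    · have h1 := hr' c e d e' hce hed hs hcd' h.rel
      exact h.consecutive d hed hs (r'.trans (r'.symm hcd') (r'.trans h1 h.rel))
  · rcases hsep with hs | hs
    · have h1 := hr' e' c e d hs hce hed h.rel hcd'
      exact h.consecutive c hs hce (r'.trans (r'.symm h1) h.rel)
    · exact lt_asymm (hed.trans hs) ham
  · rcases hsep with hs | hs
    · exact lt_asymm hce hs
    · exact lt_asymm hed hs

theorem IsMergeable.adjoin_le {r r' : Setoid (Fin N)} {a m : Fin N} (h : IsMergeable r r' a m)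
    (hle : r ≤ r') : adjoin r {a, m} ≤ r' := by
  refine NoncrossingParking.adjoin_le hle ?_
  rintro x (rfl | rfl) y (rfl | rfl)
  · exact r'.refl _
  · exact h.rel
  · exact r'.symm h.rel
  · exact r'.refl _

/-- Only `m` stops being a block minimum, so only `l = m` needs checking. There `r'` relates `m` to
its predecessor, and consecutiveness makes that predecessor `a`. -/
theorem IsMergeable.isTailConsecutive {κ : Fin N} {r r' : Setoid (Fin N)} {a m : Fin N}
    (h : IsMergeable r r' a m) (hr : IsTailConsecutive κ r) (hr' : IsTailConsecutive κ r') :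
    IsTailConsecutive κ (adjoin r {a, m}) := by
  intro l l' i hκl hl' hil hli
  by_cases hl : NonMin r l
  · obtain ⟨i', hi', hli'⟩ := hl
    exact Or.inl (hr l l' i' hκl hl' hi' hli')
  rcases adjoin_iff.1 hli with hli | ⟨⟨e, he, hle⟩, f, hf, hif⟩
  · exact absurd ⟨i, hil, hli⟩ hl
  have hlm : r l m := by
    rcases he with rfl | rfl
    · exfalso
      have hle' := le_of_not_nonMin hl hle
      rcases hf with rfl | rfl
      · exact hl ⟨i, hil, r.trans hle (r.symm hif)⟩
      · exact not_le.2 (hil.trans_le (hle'.trans h.lt.le))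
          (le_of_not_nonMin h.not_nonMin (r.symm hif))
    · exact hle
  have hlm' : l = m := le_antisymm (le_of_not_nonMin hl hlm)
    (le_of_not_nonMin h.not_nonMin (r.symm hlm))
  subst hlm'
  have h1 := hr' l l' a hκl hl' h.lt (r'.symm h.rel)
  have h2 : a = l' := by
    have hal := Fin.lt_def.1 h.lt
    have hal' : a ≤ l' := Fin.le_def.2 (by omega)
    rcases hal'.lt_or_eq with hlt | heq
    · exact absurd (r'.symm h1) (h.consecutive l' hlt (Fin.lt_def.2 (by omega)))
    · exact heq
  subst h2
  exact adjoin_of_mem _ (by simp) (by simp)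

/-- The danger is a merge of a vertex strictly between `j` and `κ` with one outside. Attachment in
`r'` and consecutiveness force `m = κ` or `a = j`. By `hj`, `r` already relates `j` to `κ`; this
excludes `m = κ`, as `m` is a block minimum, and makes `a = j` harmless. -/
theorem IsMergeable.isAttachedAt {κ j : Fin N} {r r' : Setoid (Fin N)} {a m : Fin N}
    (h : IsMergeable r r' a m) (hjκ : j < κ) (hr : IsAttachedAt κ j r) (hr' : IsAttachedAt κ j r')
    (hj : r' j κ → r j κ) :
    IsAttachedAt κ j (adjoin r {a, m}) := by
  intro y x hjy hyκ hx hyx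
  by_cases hy : ∃ z, (z ≤ j ∨ κ ≤ z) ∧ r y z
  · obtain ⟨z, hz, hyz⟩ := hy
    have := hr y z hjy hyκ hz hyz
    exact ⟨Or.inl this.1, Or.inl this.2⟩
  push Not at hy
  rcases adjoin_iff.1 hyx with hyx | ⟨hyE, f, hf, hxf⟩
  · exact absurd hyx (hy x hx)
  have hout : ∀ e ∈ ({a, m} : Set (Fin N)), j < e → e < κ → ∀ z, (z ≤ j ∨ κ ≤ z) → r e z →
      adjoin r {a, m} y j ∧ adjoin r {a, m} y κ := by
    intro e he hje heκ z hz hez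
    have := hr e z hje heκ hz hez
    exact ⟨Or.inr ⟨hyE, e, he, r.symm this.1⟩, Or.inr ⟨hyE, e, he, r.symm this.2⟩⟩
  obtain ⟨e, he, hye⟩ := hyE
  have hin : j < e ∧ e < κ := by
    by_contra! hc
    refine hy e ?_ hye
    rcases le_or_gt e j with h1 | h1
    · exact Or.inl h1
    · exact Or.inr (hc h1)
  rcases he with rfl | rfl <;> rcases hf with rfl | rfl
  · exact absurd (r.trans hye (r.symm hxf)) (hy x hx)
  · rcases lt_or_ge f κ with hfκ | hfκ
    · exact hout f (by simp) (hin.1.trans h.lt) hfκ x hx (r.symm hxf)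
    · exfalso
      have h1 := hr' e f hin.1 hin.2 (Or.inr hfκ) h.rel
      have h2 : f = κ := by
        rcases hfκ.lt_or_eq with hlt | heq
        · exact absurd (r'.trans (r'.symm h1.2) h.rel) (h.consecutive κ hin.2 hlt)
        · exact heq.symm
      subst h2
      exact h.not_nonMin ⟨j, hjκ, r.symm (hj (r'.trans (r'.symm h1.1) h1.2))⟩
  · rcases lt_or_ge j f with hjf | hjf
    · exact hout f (by simp) hjf (h.lt.trans hin.2) x hx (r.symm hxf)
    · have h1 := hr' e f hin.1 hin.2 (Or.inl hjf) (r'.symm h.rel)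
      have h2 : f = j := by
        rcases hjf.lt_or_eq with hlt | heq
        · exact absurd (r'.symm h1.1) (h.consecutive j hlt hin.1)
        · exact heq
      subst h2
      have h3 := hj (r'.trans (r'.symm h1.1) h1.2)
      have hyE : ∃ e' ∈ ({f, e} : Set (Fin N)), r y e' := ⟨e, by simp, hye⟩
      exact ⟨Or.inr ⟨hyE, f, by simp, r.refl f⟩, Or.inr ⟨hyE, f, by simp, r.symm h3⟩⟩
  · exact absurd (r.trans hye (r.symm hxf)) (hy x hx)

theorem NC.lt_iff {π π' : NC N} : π < π' ↔ π.1 < π'.1 := Iff.rfl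

theorem exists_isMergeable_of_lt {π π' : NC N} (h : π < π') :
    ∃ a m, IsMergeable π.1 π'.1 a m := by
  obtain ⟨m, hm', hm⟩ := exists_nonMin_of_lt (NC.lt_iff.1 h)
  obtain ⟨a, ha⟩ := exists_isMergeable hm hm'
  exact ⟨a, m, ha⟩

theorem NC.lt_of_rank_lt {π σ : NC N} (h : π ≤ σ) (hr : rank π.1 < rank σ.1) : π < σ :=
  lt_of_le_of_ne h fun heq => hr.ne (by rw [heq])

/-- If `π'` joins `j` to `κ` and `π` does not, this join is made first, since interior vertices may
be attached only after it. Otherwise any mergeable pair will do. -/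
theorem exists_mem_cornerSet_between {κ : Fin N} (j : CornerIndex κ) {π π' : NC N}
    (hπ : π ∈ cornerSet κ j) (hπ' : π' ∈ cornerSet κ j) (h : π < π') :
    ∃ σ ∈ cornerSet κ j, π ≤ σ ∧ σ ≤ π' ∧ rank σ.1 = rank π.1 + 1 := by
  by_cases hj : π'.1 j κ ∧ ¬ π.1 j κ
  · have hmem : π ∈ ⋂ i ∈ ({j} : Set (CornerIndex κ)), cornerSet κ i := by simpa using hπ
    have hE : cornerBlock κ {j} = {(j : Fin N), κ} := by
      rw [cornerBlock, Set.image_singleton, Set.pair_comm]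
    have hval := adjoinCorners_val hmem
    rw [hE] at hval
    refine ⟨adjoinCorners κ {j} π, by simpa using adjoinCorners_mem hmem,
      le_adjoinCorners hmem, ?_, ?_⟩
    · change (adjoinCorners κ {j} π).1 ≤ π'.1
      rw [hval]
      refine adjoin_le h.le ?_
      rintro x (rfl | rfl) y (rfl | rfl)
      · exact π'.1.refl _
      · exact hj.1
      · exact π'.1.symm hj.1
      · exact π'.1.refl _
    · rw [hval, rank_adjoin_pair hj.2]
  · obtain ⟨a, m, ham⟩ := exists_isMergeable_of_lt h
    refine ⟨⟨_, ham.isNoncrossing π.2 π'.2 h.le⟩,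
      ⟨ham.isTailConsecutive hπ.1 hπ'.1, ham.isAttachedAt j.lt hπ.2 hπ'.2 fun h1 => ?_⟩,
      le_adjoin _ _, ham.adjoin_le h.le, rank_adjoin_pair ham.not_rel⟩
    by_contra h2
    exact hj ⟨h1, h2⟩

/-- A maximal chain of the subposet skips no rank, since `exists_mem_cornerSet_between` would fill a
gap; so it is maximal in the whole lattice. -/
theorem exists_isMaximalChain {n : ℕ} {κ : Fin (n + 1)} (j : CornerIndex κ)
    {s : Set (NC (n + 1))} (hs : IsChain (· ≤ ·) s) (hsj : s ⊆ cornerSet κ j) :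
    ∃ p : Fin (n + 1) → NC (n + 1), IsMaximalChain p ∧ (∀ i, p i ∈ cornerSet κ j) ∧
      s ⊆ Set.range p := by
  have hs' : IsChain (· ≤ ·) {x : cornerSet κ j | (x : NC (n + 1)) ∈ s} := by
    intro x hx y hy hne
    exact hs hx hy fun h => hne (Subtype.ext h)
  obtain ⟨F, hF⟩ := hs'.exists_subset_flag
  have hle : ∀ x ∈ F, ∀ y ∈ F, rank x.1.1 ≤ rank y.1.1 → x ≤ y := by
    intro x hx y hy hxy
    rcases F.le_or_le hx hy with h | h
    · exact h
    · rcases h.lt_or_eq with h | h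
      · exact absurd (rank_lt_rank (NC.lt_iff.1 (Subtype.coe_lt_coe.2 h))) (not_lt.2 hxy)
      · exact h.ge
  have hbot : (⟨⊥, bot_mem_cornerSet κ j⟩ : cornerSet κ j) ∈ F :=
    Flag.mem_iff_forall_le_or_ge.2 fun b _ => Or.inl (show (⊥ : NC (n + 1)) ≤ b.1 from bot_le)
  have htop : (⟨⊤, top_mem_cornerSet κ j⟩ : cornerSet κ j) ∈ F :=
    Flag.mem_iff_forall_le_or_ge.2 fun b _ => Or.inr (show b.1 ≤ (⊤ : NC (n + 1)) from le_top)
  have hex : ∀ i : Fin (n + 1), ∃ x ∈ F, rank x.1.1 = i := by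
    intro i
    obtain ⟨x, hx, hxmax⟩ := Set.exists_max_image {x | x ∈ F ∧ rank x.1.1 ≤ i}
      (fun x => rank x.1.1) (Set.toFinite _) ⟨_, hbot, (rank_bot.trans_le (Nat.zero_le _))⟩
    refine ⟨x, hx.1, le_antisymm hx.2 ?_⟩
    by_contra! hlt
    obtain ⟨x', hx', hxmin⟩ := Set.exists_min_image {x | x ∈ F ∧ (i : ℕ) ≤ rank x.1.1} (fun x => rank x.1.1) (Set.toFinite _)
      ⟨_, htop, (Nat.lt_succ_iff.1 i.2).trans rank_top.ge⟩
    have hxx' : x.1 < x'.1 := NC.lt_of_rank_lt (hle x hx.1 x' hx'.1 (hx.2.trans hx'.2))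
      (hlt.trans_le hx'.2)
    obtain ⟨σ, hσ, h1, h2, h3⟩ := exists_mem_cornerSet_between j x.2 x'.2 hxx'
    have hσF : (⟨σ, hσ⟩ : cornerSet κ j) ∈ F := by
      refine Flag.mem_iff_forall_le_or_ge.2 fun b hb => ?_
      rcases le_total (rank b.1.1) i with h | h
      · exact Or.inr ((hle b hb x hx.1 (hxmax b ⟨hb, h⟩)).trans h1)
      · exact Or.inl (le_trans (b := x') h2 (hle x' hx'.1 b hb (hxmin b ⟨hb, h⟩)))
    have := hxmax _ ⟨hσF, show rank σ.1 ≤ i by omega⟩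
    exact absurd this (not_le.2 (by change rank x.1.1 < rank σ.1; omega))
  choose q hqF hq using hex
  refine ⟨fun i => (q i).1, ⟨?_, ?_, fun i => ⟨?_, fun c h1 h2 => ?_⟩⟩, fun i => (q i).2, ?_⟩
  · refine le_antisymm (hle _ (hqF 0) _ hbot ?_) bot_le
    rw [hq]
    exact Nat.zero_le _
  · refine le_antisymm le_top (hle _ htop _ (hqF _) ?_)
    rw [hq]
    exact rank_top.le
  · refine NC.lt_of_rank_lt (hle _ (hqF _) _ (hqF _) ?_) ?_ <;> simp [hq]
  · have h3 := rank_lt_rank (NC.lt_iff.1 h1)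
    have h4 := rank_lt_rank (NC.lt_iff.1 h2)
    simp only [hq, Fin.val_castSucc, Fin.val_succ] at h3 h4
    omega
  · intro x hx
    let x' : cornerSet κ j := ⟨x, hsj hx⟩
    have hx' : x' ∈ F := hF hx
    have hrank : rank x.1 < n + 1 := by
      rcases (le_top : x ≤ ⊤).lt_or_eq with h | h
      · exact (rank_lt_rank (NC.lt_iff.1 h)).trans (rank_top.trans_lt (Nat.lt_succ_self n))
      · rw [h]
        exact rank_top.trans_lt (Nat.lt_succ_self n)
    refine ⟨⟨rank x.1, hrank⟩, ?_⟩
    have h1 : rank (q ⟨rank x.1, hrank⟩).1.1 = rank x'.1.1 := hq _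
    exact le_antisymm (hle _ (hqF _) _ hx' h1.le) (hle _ hx' _ (hqF _) h1.ge)

end Merge

end NoncrossingParking

namespace NoncrossingParking

/-! ### Labels of chains, and the chains with largest undesired space `κ` -/

section Labels

variable {N : ℕ}

theorem nextInBlock_congr {r r' : Setoid (Fin N)} {v : Fin N} (h : ∀ w, r v w ↔ r' v w) :
    nextInBlock r v = nextInBlock r' v := by
  obtain ⟨h1, h2⟩ := nextInBlock_spec r v
  obtain ⟨h1', h2'⟩ := nextInBlock_spec r' v
  rcases h2 with h2 | h2 <;> rcases h2' with h2' | h2'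
  · exact le_antisymm (h2.2 _ ((h _).2 h1') h2'.1) (h2'.2 _ ((h _).1 h1) h2.1)
  · exact absurd (h2'.1 _ ((h _).1 h1)) (not_le.2 h2.1)
  · exact absurd (h2.1 _ ((h _).2 h1')) (not_le.2 h2'.1)
  · exact le_antisymm (h2.2 _ ((h _).2 h1')) (h2'.2 _ ((h _).1 h1))

theorem nextInBlock_eq {r : Setoid (Fin N)} {v w : Fin N} (hvw : r v w) (hlt : v < w)
    (hw : ∀ x, r v x → v < x → w ≤ x) : nextInBlock r v = w := by
  obtain ⟨h1, h2 | h2⟩ := nextInBlock_spec r v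
  · exact le_antisymm (h2.2 w hvw hlt) (hw _ h1 h2.1)
  · exact absurd (h2.1 w hvw) (not_le.2 hlt)

theorem perm_apply (r : Setoid (Fin N)) (v : Fin N) : perm r v = nextInBlock r v := rfl

/-- The label of the step that merges the blocks of `a` and `m`. -/
theorem IsMergeable.smallestMoved_eq {r r' : Setoid (Fin N)} {a m : Fin N}
    (h : IsMergeable r r' a m) (hr' : r' = adjoin r {a, m}) :
    smallestMoved ((perm r)⁻¹ * perm r') = (a : ℕ) + 1 := by
  have hle : r ≤ r' := by
    rw [hr']
    exact le_adjoin _ _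
  have hmoved : ∀ v, ((perm r)⁻¹ * perm r') v ≠ v ↔ nextInBlock r' v ≠ nextInBlock r v := by
    intro v
    rw [Equiv.Perm.mul_apply, ne_eq, Equiv.Perm.inv_eq_iff_eq, perm_apply, perm_apply]
  have hnext : nextInBlock r' a = m := by
    refine nextInBlock_eq h.rel h.lt fun x hax hlt => ?_
    by_contra! hxm
    exact h.consecutive x hlt hxm (r'.trans (r'.symm hax) h.rel)
  refine IsLeast.csInf_eq ⟨⟨a, (hmoved a).2 ?_, rfl⟩, ?_⟩
  · rw [hnext]
    intro heq
    refine h.not_rel ?_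
    rw [heq]
    exact (nextInBlock_spec r a).1
  · rintro _ ⟨v, hv, rfl⟩
    by_contra! hlt
    have hva : v < a := Fin.lt_def.2 (by omega)
    have hvm : ¬ r v m := fun hvm => h.not_nonMin ⟨v, hva.trans h.lt, r.symm hvm⟩
    refine (hmoved v).1 hv ?_
    -- If `v < a` is in the block of `a`, its next vertex is at most `a`, whereas all vertices newly
    -- joined to it are at least `m > a`.
    by_cases hav : r v a
    · obtain ⟨h1, h2 | h2⟩ := nextInBlock_spec r v
      · refine nextInBlock_eq (hle h1) h2.1 fun x hvx hvx' => ?_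
        rw [hr'] at hvx
        rcases adjoin_iff.1 hvx with hvx | ⟨-, e, he, hxe⟩
        · exact h2.2 x hvx hvx'
        · rcases he with rfl | rfl
          · exact h2.2 x (r.trans hav (r.symm hxe)) hvx'
          · exact (h2.2 a hav hva).trans
              (h.lt.le.trans (le_of_not_nonMin h.not_nonMin (r.symm hxe)))
      · exact absurd (h2.1 a hav) (not_le.2 hva)
    · refine nextInBlock_congr fun w => ⟨fun hw => ?_, fun hw => hle hw⟩
      rw [hr'] at hw
      rcases adjoin_iff.1 hw with hw | ⟨⟨e, he, hve⟩, -⟩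
      · exact hw
      · rcases he with rfl | rfl
        · exact absurd hve hav
        · exact absurd hve hvm

theorem exists_eq_adjoin_of_covBy {π π' : NC N} (h : π ⋖ π') :
    ∃ a m, IsMergeable π.1 π'.1 a m ∧ π'.1 = adjoin π.1 {a, m} := by
  obtain ⟨a, m, ham⟩ := exists_isMergeable_of_lt h.lt
  refine ⟨a, m, ham, ?_⟩
  let σ : NC N := ⟨_, ham.isNoncrossing π.2 π'.2 h.lt.le⟩
  have h1 : π < σ := NC.lt_of_rank_lt (le_adjoin _ _) (by
    change rank π.1 < rank (adjoin π.1 {a, m})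
    rw [rank_adjoin_pair ham.not_rel]
    exact Nat.lt_succ_self _)
  have h2 : σ ≤ π' := ham.adjoin_le h.lt.le
  rcases h2.lt_or_eq with h2 | h2
  · exact absurd h2 (h.2 h1)
  · exact (congrArg Subtype.val h2).symm

theorem exists_step {n : ℕ} {f : Fin (n + 1) → Prop} (h0 : ¬ f 0) (hl : f (Fin.last n)) :
    ∃ i : Fin n, ¬ f i.castSucc ∧ f i.succ := by
  by_contra! h
  have : ∀ i, ¬ f i := fun i => Fin.induction h0 (fun i hi => h i hi) i
  exact this _ hl

variable {n : ℕ} {p : Fin (n + 1) → NC (n + 1)}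

theorem IsMaximalChain.monotone (hp : IsMaximalChain p) : Monotone p :=
  Fin.monotone_iff_le_succ.2 fun i => (hp.2.2 i).le

/-- Step `i` turns exactly `m i` from a block minimum into a non-minimum. Along the chain this
happens once to every vertex except 0. -/
theorem IsMaximalChain.exists_steps (hp : IsMaximalChain p) : ∃ a m : Fin n → Fin (n + 1),
    (∀ i, IsMergeable (p i.castSucc).1 (p i.succ).1 (a i) (m i)) ∧
    (∀ i, (p i.succ).1 = adjoin (p i.castSucc).1 {a i, m i}) ∧
    (∀ i, stanleyWord p i = (a i : ℕ) + 1) ∧ Function.Injective m ∧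
    ∀ v : Fin (n + 1), v ≠ 0 → ∃ i, m i = v := by
  choose a m ham heq using fun i => exists_eq_adjoin_of_covBy (hp.2.2 i)
  have hnm : ∀ i, NonMin (p i.succ).1 (m i) := fun i =>
    ⟨a i, (ham i).lt, (p i.succ).1.symm (ham i).rel⟩
  have hlt : ∀ i i', i < i' → m i ≠ m i' := by
    intro i i' hii' h
    refine (ham i').not_nonMin (h ▸ (hnm i).mono (hp.monotone ?_))
    exact Fin.le_def.2 (by simpa using hii')
  refine ⟨a, m, ham, heq, fun i => (ham i).smallestMoved_eq (heq i), ?_, ?_⟩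
  · intro i i' h
    rcases lt_trichotomy i i' with h1 | h1 | h1
    · exact absurd h (hlt i i' h1)
    · exact h1
    · exact absurd h.symm (hlt i' i h1)
  · intro v hv
    obtain ⟨i, h1, h2⟩ := exists_step (f := fun i => NonMin (p i).1 v)
      (by
        rw [hp.1]
        rintro ⟨i, hi, h⟩
        have h : v = i := h
        exact hi.ne h.symm)
      (by
        rw [hp.2.1]
        exact ⟨0, Fin.pos_iff_ne_zero.2 hv, trivial⟩)
    refine ⟨i, ?_⟩
    obtain ⟨α, -, haα, hα⟩ := exists_not_nonMin (p i.castSucc).1 (a i)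
    have hαm : α < m i := (le_of_not_nonMin hα ((p i.castSucc).1.symm haα)).trans_lt (ham i).lt
    rw [heq i, nonMin_adjoin_pair hα (ham i).not_nonMin hαm haα
      ((p i.castSucc).1.refl _)] at h2
    exact (h2.resolve_right h1).symm

/-- If the sorted entry at the 0-based position `i` were at least `i + 2`, the `n - i` entries from
there on would give as many distinct values of `m` in `{i + 2, …, n}`, which is too small. -/
theorem mem_PF_of_injective {w : Fin n → ℕ} (hw : ∀ i, 1 ≤ w i) {m : Fin n → Fin (n + 1)}
    (hm : Function.Injective m) (h : ∀ i, w i ≤ m i) : w ∈ PF n := by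
  refine ⟨hw, fun i => ?_⟩
  by_contra! hlt
  have hmono := Tuple.monotone_sort w
  have hcard := Finset.card_le_card_of_injOn (s := Finset.Ici i)
    (t := Finset.Icc ((i : ℕ) + 2) n) (fun i' => (m (Tuple.sort w i') : ℕ)) ?_ ?_
  · rw [Fin.card_Ici, Nat.card_Icc] at hcard
    have := i.2
    omega
  · intro i' hi'
    have h1 : w (Tuple.sort w i) ≤ w (Tuple.sort w i') := hmono (by simpa using hi')
    have h2 := h (Tuple.sort w i')
    have h3 := (m (Tuple.sort w i')).2
    simp only [Finset.coe_Icc, Set.mem_Icc]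
    omega
  · intro x _ y _ hxy
    exact (Tuple.sort w).injective (hm (Fin.val_injective hxy))

/-- The maximal chains for which `κ` is the largest undesired space run through partitions with a
common corner. -/
theorem IsMaximalChain.stanleyWord_mem_iff (hp : IsMaximalChain p) {κ : Fin (n + 1)}
    (hκ : 0 < (κ : ℕ)) :
    stanleyWord p ∈ PFUndesired n κ ↔ ∃ j : CornerIndex κ, ∀ i, p i ∈ cornerSet κ j := by
  obtain ⟨a, m, ham, heq, hword, hinj, hsurj⟩ := hp.exists_steps
  have hlt : ∀ i, (a i : ℕ) < m i := fun i => Fin.lt_def.1 (ham i).lt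
  have hκn : (κ : ℕ) ≤ n := Nat.lt_succ_iff.1 κ.2
  -- `u` is the vertex whose label is the number `κ`: that space is undesired iff no `a i` equals
  -- `u`.
  let u : Fin (n + 1) := ⟨(κ : ℕ) - 1, (Nat.sub_le _ _).trans_lt κ.2⟩
  have hu : (u : ℕ) + 1 = κ := Nat.sub_add_cancel hκ
  have huκ : u < κ := Fin.lt_def.2 (by omega)
  constructor
  · rintro ⟨-, ⟨-, -, hmiss⟩, hmax⟩
    have hoccur : ∀ v, (κ : ℕ) < v → v ≤ n → ∃ i, (a i : ℕ) + 1 = v := by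
      intro v hv hvn
      by_contra! hne
      refine not_le.2 hv (hmax ⟨by omega, hvn, fun i => ?_⟩)
      rw [hword]
      exact hne i
    -- Downward induction on `m i`. The label `m i` occurs at some step `i'` with `m i' ≥ m i`;
    -- strict inequality would give `a i' + 1 = m i'` by induction, so `i' = i`.
    have hpred : ∀ d i, (m i : ℕ) + d = n → (κ : ℕ) < m i → (a i : ℕ) + 1 = m i := by
      intro d
      induction d using Nat.strong_induction_on with
      | _ d ih =>
        intro i hd hi
        obtain ⟨i', hi'⟩ := hoccur (m i) hi (Nat.lt_succ_iff.1 (m i).2)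
        have h1 := hlt i'
        have h2 := (m i').2
        rcases (show (m i : ℕ) ≤ m i' by omega).lt_or_eq with h | h
        · have := ih (n - m i') (by omega) i' (by omega) (by omega)
          omega
        · rw [← hinj (Fin.val_injective h)] at hi'
          exact hi'
    have htail : ∀ t, IsTailConsecutive κ (p t).1 := by
      intro t l l' i hκl hl' hil hli
      obtain ⟨s, rfl⟩ := hsurj l ((Fin.zero_le _).trans_lt hil).ne'
      have h1 := hpred (n - m s) s (by have := (m s).2; omega) hκl
      have h2 : a s = l' := Fin.val_injective (by omega)
      have h3 : s.succ ≤ t := by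
        by_contra! h3
        refine (ham s).not_nonMin ⟨i, hil, hp.monotone ?_ hli⟩
        rw [Fin.lt_def] at h3
        rw [Fin.le_def]
        simp only [Fin.val_succ, Fin.val_castSucc] at h3 ⊢
        omega
      rw [← h2]
      exact (p t).1.symm (hp.monotone h3 (ham s).rel)
    -- At step `s` the vertices `u` and `κ` are joined; the corner is `a s`.
    obtain ⟨s, hs, hs'⟩ := exists_step (f := fun i => (p i).1 u κ)
      (by
        rw [hp.1]
        intro h
        have h : u = κ := h
        exact huκ.ne h)
      (by
        rw [hp.2.1]
        trivial)
    have hsplit : (p s.castSucc).1 κ (a s) ∧ (p s.castSucc).1 u (m s) := by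
      rw [heq s] at hs'
      rcases adjoin_iff.1 hs' with h | ⟨⟨e, he, hue⟩, f, hf, hκf⟩
      · exact absurd h hs
      rcases he with rfl | rfl <;> rcases hf with rfl | rfl
      · exact absurd ((p s.castSucc).1.trans hue ((p s.castSucc).1.symm hκf)) hs
      -- The opposite arrangement, `a s` with `u` and `m s` with `κ`. As label `κ` is missing, `a s
      -- < u` in the case `m s = κ`, and `u` lies between consecutive vertices; if `m s < κ`, the
      -- two blocks cross.
      · exfalso
        have hmκ := le_of_not_nonMin (ham s).not_nonMin ((p s.castSucc).1.symm hκf)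
        have hau : (a s : ℕ) ≠ u := fun h => hmiss s (by rw [hword]; omega)
        rcases hmκ.lt_or_eq with hmκ | hmκ
        · have hmu : m s ≠ u := fun h => hs (h ▸ (p s.castSucc).1.symm hκf)
          have hmu' : m s < u := by
            rw [Fin.lt_def] at hmκ ⊢
            have : (m s : ℕ) ≠ u := fun h => hmu (Fin.val_injective h)
            omega
          refine (ham s).not_rel ((p s.castSucc).2 (a s) (m s) u κ (ham s).lt hmu' huκ
            ((p s.castSucc).1.symm hue) ((p s.castSucc).1.symm hκf))
        · have h1 := hlt s
          have h2 : a s < u := Fin.lt_def.2 (by rw [hmκ] at h1; omega)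
          refine (ham s).consecutive u h2 (hmκ ▸ huκ) ?_
          refine (p s.succ).1.trans ?_ (ham s).rel
          exact hp.monotone (Fin.castSucc_le_succ s) hue
      · exact ⟨hκf, hue⟩
      · exact absurd ((p s.castSucc).1.trans hue ((p s.castSucc).1.symm hκf)) hs
    obtain ⟨hκa, hum⟩ := hsplit
    have hmu := le_of_not_nonMin (ham s).not_nonMin ((p s.castSucc).1.symm hum)
    have hau : a s < u := (ham s).lt.trans_le hmu
    have haκ : a s < κ := hau.trans huκ
    -- Once `a s` and `κ` are joined, attachment is automatic: another block cannot cross the chord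
    -- between them.
    have hlate : ∀ t, (p t).1 (a s) κ → IsAttachedAt κ (a s) (p t).1 := by
      intro t hat y x hay hyκ hx hyx
      have hya : (p t).1 y (a s) := by
        by_contra hne
        have hne' : ¬ (p t).1 (a s) y := fun h => hne ((p t).1.symm h)
        have := (p t).2.between hat hyx hay hyκ hne'
        rcases hx with hx | hx
        · exact not_le.2 this.1 hx
        · exact not_le.2 this.2 hx
      exact ⟨hya, (p t).1.trans hya hat⟩
    refine ⟨⟨a s, by rw [Fin.lt_def] at hau; omega⟩, fun t => ⟨htail t, ?_⟩⟩
    change IsAttachedAt κ (a s) (p t).1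
    by_cases hat : (p t).1 (a s) κ
    · exact hlate t hat
    · intro y x hay hyκ hx hyx
      exfalso
      -- A premature attachment of `y` persists until just before step `s`. Then `a s < m s < y < u`
      -- and the blocks of `a s` and `m s` cross.
      have hts : t ≤ s.castSucc := by
        by_contra! hts
        exact hat (hp.monotone hts.le ((p s.castSucc).1.symm hκa))
      have hya := (hlate s.castSucc ((p s.castSucc).1.symm hκa) y x hay hyκ hx
        (hp.monotone hts hyx)).1
      have hya' : (p s.castSucc).1 y κ := (p s.castSucc).1.trans hya ((p s.castSucc).1.symm hκa)
      have hmy : m s < y := by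
        refine lt_of_le_of_ne (not_lt.1 fun h => ?_) ?_
        · refine (ham s).consecutive y hay h ((p s.succ).1.trans ?_ (ham s).rel)
          exact hp.monotone (Fin.castSucc_le_succ s) hya
        · rintro rfl
          exact (ham s).not_rel ((p s.castSucc).1.symm hya)
      have hyu : y < u := by
        rw [Fin.lt_def] at hyκ ⊢
        have : (y : ℕ) ≠ u := fun h => hs (Fin.val_injective h ▸ hya')
        omega
      exact (ham s).not_rel ((p s.castSucc).2 (a s) (m s) y u (ham s).lt hmy hyu
        ((p s.castSucc).1.symm hya) ((p s.castSucc).1.symm hum))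
  · rintro ⟨j, hj⟩
    refine ⟨mem_PF_of_injective (fun i => ?_) hinj fun i => ?_, ⟨hκ, hκn, fun i hi => ?_⟩, ?_⟩
    · rw [hword]
      omega
    · rw [hword]
      exact hlt i
    -- If `a i = u`, attachment forces `m i = κ`. Before the step `κ` is a block minimum, so `j` was
    -- already with `u`; attachment then joins `u` to `κ` too early.
    · rw [hword] at hi
      have hau : a i = u := Fin.val_injective (by omega)
      have hju : (j : Fin (n + 1)) < u := by
        have := j.2
        exact Fin.lt_def.2 (by omega)
      have hκm : κ ≤ m i := by
        have := hlt i
        rw [hau] at this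
        exact Fin.le_def.2 (by omega)
      have hrel := (ham i).rel
      rw [hau] at hrel
      have h1 := (hj i.succ).2 u (m i) hju huκ (Or.inr hκm) hrel
      have hmκ : m i = κ := by
        rcases hκm.lt_or_eq with h | h
        · exact absurd ((p i.succ).1.trans ((p i.succ).1.symm h1.2) hrel)
            ((ham i).consecutive κ (hau ▸ huκ) h)
        · exact h.symm
      have hnm := (ham i).not_nonMin
      have hnr := (ham i).not_rel
      rw [hmκ] at hnm
      rw [hau, hmκ] at hnr
      have h2 : (p i.castSucc).1 u j := by
        have h3 := h1.1
        rw [heq i, hau, hmκ] at h3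
        rcases adjoin_iff.1 h3 with h3 | ⟨-, e, he, hje⟩
        · exact h3
        · rcases he with rfl | rfl
          · exact (p i.castSucc).1.symm hje
          · exact absurd ⟨j, j.lt, (p i.castSucc).1.symm hje⟩ hnm
      exact hnr ((hj i.castSucc).2 u j hju huκ (Or.inl le_rfl) h2).2
    -- Any `v > κ` is the label of the step at which vertex `v` ceases to be a block minimum.
    · rintro v ⟨hv1, hvn, hv⟩
      by_contra! hlt'
      let l : Fin (n + 1) := ⟨v, Nat.lt_succ_iff.2 hvn⟩
      let l' : Fin (n + 1) := ⟨v - 1, (Nat.sub_le _ _).trans_lt l.2⟩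
      obtain ⟨i, hi⟩ := hsurj l fun h => by
        have : v = 0 := congrArg Fin.val h
        omega
      have hl' : (l' : ℕ) + 1 = l := Nat.sub_add_cancel hv1
      have hi' : (m i : ℕ) = v := congrArg Fin.val hi
      have h1 := (hj i.succ).1 (m i) l' (a i) (by rw [hi]; exact Fin.lt_def.2 hlt')
        (by rw [hi]; exact hl') (ham i).lt ((p i.succ).1.symm (ham i).rel)
      refine hv i ?_
      rw [hword]
      have h2 := hlt i
      have h3 : (l' : ℕ) + 1 = v := hl'
      by_contra hne
      exact (ham i).consecutive l' (Fin.lt_def.2 (by omega)) (Fin.lt_def.2 (by omega))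
        ((p i.succ).1.symm h1)

theorem mem_labeledComplex_iff {κ : Fin (n + 1)} (hκ : 0 < (κ : ℕ)) (s : Finset (NC (n + 1))) :
    s ∈ labeledComplex (PFUndesired n κ) ↔ s.Nonempty ∧
      IsChain (· ≤ ·) (s : Set (NC (n + 1))) ∧
      ∃ j : CornerIndex κ, ∀ x ∈ s, x ∈ cornerSet κ j ∧ x ≠ ⊥ ∧ x ≠ ⊤ := by
  constructor
  · rintro ⟨hs, p, hp, hA, hsub⟩
    obtain ⟨j, hj⟩ := (hp.stanleyWord_mem_iff hκ).1 hA
    refine ⟨hs, ?_, j, fun x hx => ?_⟩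
    · exact (hp.monotone.isChain_range).mono fun x hx => (hsub x hx).2.2
    · obtain ⟨h1, h2, i, rfl⟩ := hsub x hx
      exact ⟨hj i, h1, h2⟩
  · rintro ⟨hs, hc, j, hj⟩
    obtain ⟨p, hp, hpj, hsub⟩ := exists_isMaximalChain j hc fun x hx => (hj x hx).1
    exact ⟨hs, p, hp, (hp.stanleyWord_mem_iff hκ).2 ⟨j, hpj⟩,
      fun x hx => ⟨(hj x hx).2.1, (hj x hx).2.2, hsub hx⟩⟩

theorem labeledComplex_le_link (A : Set (Fin n → ℕ)) :
    labeledComplex A ≤ link (NC (n + 1)) := by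
  rintro s ⟨hs, p, hp, -, hsub⟩
  exact ⟨hs, (hp.monotone.isChain_range).mono fun x hx => (hsub x hx).2.2,
    fun h => (hsub _ h).1 rfl, fun h => (hsub _ h).2.1 rfl⟩

end Labels

end NoncrossingParking

theorem theorem4 (n k : ℕ) (hk : 1 < k) (hkn : k ≤ n) :
    NoncrossingParking.labeledComplex (NoncrossingParking.PFUndesired n k) ≤
        NoncrossingParking.link (NoncrossingParking.NC (n + 1)) ∧
      ContractibleSpace (NoncrossingParking.realization
        (NoncrossingParking.labeledComplex (NoncrossingParking.PFUndesired n k))) :=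
  ⟨NoncrossingParking.labeledComplex_le_link _,
    NoncrossingParking.contractibleSpace_of_cornerSet (κ := ⟨k, Nat.lt_succ_iff.2 hkn⟩) hk
      (NoncrossingParking.mem_labeledComplex_iff (κ := ⟨k, Nat.lt_succ_iff.2 hkn⟩)
        (Nat.zero_lt_of_lt hk))⟩
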